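/- **Theorem 5.5.** Let $a<b$ and $c<d$ be real, let $n,m\ge 0$ be integers, let $\varphi_1,\dots,\varphi_n$ be an orthonormal system in the complex space $L_2[a,b]$, $\psi_1,\dots,\psi_m$ an orthonormal system in $L_2[c,d]$, and let $h_1,\dots,h_n$ and $p_1,\dots,p_m$ be essentially bounded real functions on $[c,d]$ and $[a,b]$ respectively. On $L_2([a,b]\times[c,d])$ define the bounded self-adjoint partial integral operators $$T_1f(x,y)=\int_a^b\sum_{k=1}^n\varphi_k(x)\overline{\varphi_k(s)}h_k(y)f(s,y)\,ds,\qquad T_2f(x,y)=\int_c^d\sum_{j=1}^m p_j(x)\psi_j(y)\overline{\psi_j(t)}f(x,t)\,dt,$$ and $T=T_1+T_2$. Let $\sigma$ denote the spectrum, $\rho$ the resolvent set, $E$ the identity, and let $\sigma_{disc}(T)$ be the set of isolated points of $\sigma(T)$ that are eigenvalues of finite multiplicity. For $\tau\ne0$ with $\tau^{-1}\in\rho(T_1)\cap\rho(T_2)$ put $$S_1(\tau)f(x,y)=\sum_{k=1}^n\frac{h_k(y)}{1-\tau h_k(y)}\int_a^b\varphi_k(x)\overline{\varphi_k(s)}f(s,y)\,ds,\qquad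 W_1(\tau)=(E-\tau T_2)^{-1}S_1(\tau)T_2 .$$ The operator $W_1(\tau)$ has finite rank; let $\Delta_1(\tau)$ be the Fredholm determinant of $E-\tau^2W_1(\tau)$ (for an operator $A$ of finite rank, the Fredholm determinant of $E-A$ is the determinant of the restriction of $E-A$ to the range of $A$), and let $$\mathcal D_0(T)=\{1/\tau:\ \tau\neq0,\ \tau^{-1}\in\rho(T_1)\cap\rho(T_2),\ \Delta_1(\tau)=0\}.$$ For $\lambda\in G=\mathbb C\setminus(\sigma(T_1)\cup\sigma(T_2))$, $1\le k\le m$ and $1\le j\le n$ let $$F_{k,j}(x,y;\lambda)=\varphi_j(x)\Bigl(\frac{\psi_k(y)h_j(y)}{\lambda-h_j(y)}+\sum_{i=1}^m\frac{p_i(x)\psi_i(y)}{\lambda-p_i(x)}\int_c^d\frac{h_j(\xi)}{\lambda-h_j(\xi)}\psi_k(\xi)\overline{\psi_i(\xi)}\,d\xi\Bigr),\qquad B_{k,j}(s,t)=p_k(s)\overline{\varphi_j(s)}\,\overline{\psi_k(t)},$$ let $\Pi(\lambda)$ be the $mn\times mn$ matrix, indexed by pairs $\omega=(k,j)$, with entries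 $\Pi_{\omega,\omega'}(\lambda)=\int_a^b\int_c^dF_\omega(x,y;\lambda)B_{\omega'}(x,y)\,dx\,dy$, and let $\Delta(\lambda)=\det(\Pi(\lambda)-\lambda I)$. Then $$\sigma_{disc}(T)=\mathcal D_0(T)=\{\lambda\in G:\ \Delta(\lambda)=0\}.$$ -/

import Mathlib

open MeasureTheory Set
open scoped ENNReal ComplexConjugate

set_option linter.unusedSectionVars false

noncomputable section

namespace PartialInt

section General

variable {α β : Type*} [MeasurableSpace α] [MeasurableSpace β]

/-! ### Partial integration against a rank-one kernel -/

/-- `(x, y) ↦ ∫ φ(x) * conj φ(s) * f(s, y) dμ(s)`. -/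
def projFun₁ (μ : Measure α) (φ : α → ℂ) (f : α × β → ℂ) (z : α × β) : ℂ :=
  ∫ s, φ z.1 * conj (φ s) * f (s, z.2) ∂μ

/-- `(x, y) ↦ ∫ ψ(y) * conj ψ(t) * f(x, t) dν(t)`. -/
def projFun₂ (ν : Measure β) (ψ : β → ℂ) (f : α × β → ℂ) (z : α × β) : ℂ :=
  ∫ t, ψ z.2 * conj (ψ t) * f (z.1, t) ∂ν

variable {μ : Measure α} {ν : Measure β} [SFinite μ] [SFinite ν]

theorem lintegral_enorm_sq_eq {γ : Type*} [MeasurableSpace γ] (ρ : Measure γ) (f : γ → ℂ) :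
    ∫⁻ z, ‖f z‖ₑ ^ (2 : ℝ) ∂ρ = (eLpNorm f 2 ρ) ^ (2 : ℝ) := by
  rw [eLpNorm_eq_lintegral_rpow_enorm_toReal two_ne_zero ENNReal.ofNat_ne_top]
  simp only [ENNReal.toReal_ofNat]
  rw [← ENNReal.rpow_mul]
  norm_num

theorem aestronglyMeasurable_projFun₁ {φ : α → ℂ} {f : α × β → ℂ}
    (hφ : AEStronglyMeasurable φ μ) (hf : AEStronglyMeasurable f (μ.prod ν)) :
    AEStronglyMeasurable (projFun₁ (β := β) μ φ f) (μ.prod ν) := by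
  have h1 : AEStronglyMeasurable (fun w : β × α => conj (φ w.2) * f (w.2, w.1)) (ν.prod μ) := by
    refine AEStronglyMeasurable.mul ?_ hf.prod_swap
    exact (RCLike.continuous_conj.comp_aestronglyMeasurable hφ).comp_snd
  have h2 : AEStronglyMeasurable (fun y => ∫ s, conj (φ s) * f (s, y) ∂μ) ν :=
    h1.integral_prod_right'
  have h3 : projFun₁ (β := β) μ φ f =
      fun z : α × β => φ z.1 * ∫ s, conj (φ s) * f (s, z.2) ∂μ := by
    funext z
    simp only [projFun₁, mul_assoc, integral_const_mul]
  rw [h3]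
  exact hφ.comp_fst.mul h2.comp_snd

theorem eLpNorm_projFun₁_le {φ : α → ℂ} {f : α × β → ℂ}
    (hφ : AEStronglyMeasurable φ μ) (hf : AEStronglyMeasurable f (μ.prod ν)) :
    eLpNorm (projFun₁ (β := β) μ φ f) 2 (μ.prod ν) ≤
      eLpNorm φ 2 μ * eLpNorm φ 2 μ * eLpNorm f 2 (μ.prod ν) := by
  have hfs : AEStronglyMeasurable (fun w : β × α => f w.swap) (ν.prod μ) := hf.prod_swap
  have key : ∫⁻ z, ‖projFun₁ (β := β) μ φ f z‖ₑ ^ (2 : ℝ) ∂(μ.prod ν) ≤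
      (eLpNorm φ 2 μ * eLpNorm φ 2 μ * eLpNorm f 2 (μ.prod ν)) ^ (2 : ℝ) := by
    have hB : AEMeasurable (fun y => ∫⁻ s, ‖f (s, y)‖ₑ ^ (2 : ℝ) ∂μ) ν :=
      (hfs.enorm.pow_const (2 : ℝ)).lintegral_prod_right'
    calc ∫⁻ z, ‖projFun₁ (β := β) μ φ f z‖ₑ ^ (2 : ℝ) ∂(μ.prod ν)
        ≤ ∫⁻ z : α × β, ‖φ z.1‖ₑ ^ (2 : ℝ) *
            ((eLpNorm φ 2 μ) ^ (2 : ℝ) * ∫⁻ s, ‖f (s, z.2)‖ₑ ^ (2 : ℝ) ∂μ) ∂(μ.prod ν) := by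
          have hsec : ∀ᵐ y ∂ν, AEStronglyMeasurable (fun s => f (s, y)) μ :=
            hfs.prodMk_left
          have hsec' : ∀ᵐ z ∂(μ.prod ν), AEStronglyMeasurable (fun s => f (s, z.2)) μ :=
            Measure.quasiMeasurePreserving_snd.ae hsec
          refine lintegral_mono_ae ?_
          filter_upwards [hsec'] with z hz
          have e : projFun₁ (β := β) μ φ f z = φ z.1 * ∫ s, conj (φ s) * f (s, z.2) ∂μ := by
            simp only [projFun₁, mul_assoc, integral_const_mul]
          rw [e, enorm_mul, ENNReal.mul_rpow_of_nonneg _ _ (by norm_num)]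
          gcongr
          have h1 : ‖∫ s, conj (φ s) * f (s, z.2) ∂μ‖ₑ ≤
              (∫⁻ s, ‖φ s‖ₑ ^ (2 : ℝ) ∂μ) ^ (1 / (2 : ℝ)) *
                (∫⁻ s, ‖f (s, z.2)‖ₑ ^ (2 : ℝ) ∂μ) ^ (1 / (2 : ℝ)) := by
            refine (enorm_integral_le_lintegral_enorm _).trans ?_
            have := ENNReal.lintegral_mul_le_Lp_mul_Lq μ Real.HolderConjugate.two_two
              hφ.enorm hz.enorm
            refine le_trans (le_of_eq ?_) this
            refine lintegral_congr fun s => ?_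
            simp [enorm_mul]
          refine (ENNReal.rpow_le_rpow h1 (by norm_num)).trans (le_of_eq ?_)
          rw [ENNReal.mul_rpow_of_nonneg _ _ (by norm_num), ← ENNReal.rpow_mul,
            ← ENNReal.rpow_mul, lintegral_enorm_sq_eq]
          norm_num
      _ = (∫⁻ x, ‖φ x‖ₑ ^ (2 : ℝ) ∂μ) *
            ∫⁻ y, ((eLpNorm φ 2 μ) ^ (2 : ℝ) * ∫⁻ s, ‖f (s, y)‖ₑ ^ (2 : ℝ) ∂μ) ∂ν :=
          lintegral_prod_mul (hφ.enorm.pow_const _) (hB.const_mul _)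
      _ = (eLpNorm φ 2 μ * eLpNorm φ 2 μ * eLpNorm f 2 (μ.prod ν)) ^ (2 : ℝ) := by
          rw [lintegral_const_mul'' _ hB, lintegral_enorm_sq_eq,
            ← lintegral_prod_symm _ (hf.enorm.pow_const (2 : ℝ)), lintegral_enorm_sq_eq,
            ← mul_assoc, ← ENNReal.mul_rpow_of_nonneg _ _ (by norm_num),
            ← ENNReal.mul_rpow_of_nonneg _ _ (by norm_num)]
  rw [lintegral_enorm_sq_eq] at key
  exact (ENNReal.rpow_le_rpow_iff (by norm_num)).1 key

theorem memLp_projFun₁ {φ : α → ℂ} {f : α × β → ℂ}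
    (hφ : MemLp φ 2 μ) (hf : MemLp f 2 (μ.prod ν)) :
    MemLp (projFun₁ (β := β) μ φ f) 2 (μ.prod ν) :=
  ⟨aestronglyMeasurable_projFun₁ hφ.1 hf.1, (eLpNorm_projFun₁_le hφ.1 hf.1).trans_lt
    (ENNReal.mul_lt_top (ENNReal.mul_lt_top hφ.2 hφ.2) hf.2)⟩

theorem ae_section_snd {q : α × β → Prop} (h : ∀ᵐ z ∂(μ.prod ν), q z) :
    ∀ᵐ z ∂(μ.prod ν), ∀ᵐ s ∂μ, q (s, z.2) := by
  have h1 : ∀ᵐ w ∂(ν.prod μ), q w.swap := by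
    have := Measure.measurePreserving_swap (μ := ν) (ν := μ)
    exact this.quasiMeasurePreserving.ae h
  exact Measure.quasiMeasurePreserving_snd.ae (Measure.ae_ae_of_ae_prod h1)

theorem ae_section_fst {q : α × β → Prop} (h : ∀ᵐ z ∂(μ.prod ν), q z) :
    ∀ᵐ z ∂(μ.prod ν), ∀ᵐ t ∂ν, q (z.1, t) :=
  Measure.quasiMeasurePreserving_fst.ae (Measure.ae_ae_of_ae_prod h)

theorem projFun₁_congr {φ : α → ℂ} {f g : α × β → ℂ} (h : f =ᵐ[μ.prod ν] g) :
    projFun₁ (β := β) μ φ f =ᵐ[μ.prod ν] projFun₁ (β := β) μ φ g := by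
  filter_upwards [ae_section_snd h] with z hz
  refine integral_congr_ae ?_
  filter_upwards [hz] with s hs
  rw [hs]

theorem ae_integrable_section₁ {φ : α → ℂ} {f : α × β → ℂ}
    (hφ : MemLp φ 2 μ) (hf : MemLp f 2 (μ.prod ν)) :
    ∀ᵐ z ∂(μ.prod ν), Integrable (fun s => φ z.1 * conj (φ s) * f (s, z.2)) μ := by
  have hfs : MemLp (fun w : β × α => f w.swap) 2 (ν.prod μ) :=
    hf.comp_measurePreserving Measure.measurePreserving_swap
  have h2 : Integrable (fun w : β × α => ‖f w.swap‖ ^ 2) (ν.prod μ) :=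
    hfs.integrable_norm_pow two_ne_zero
  have h3 : ∀ᵐ y ∂ν, Integrable (fun s => ‖f (s, y)‖ ^ 2) μ := h2.prod_right_ae
  have h4 : ∀ᵐ y ∂ν, AEStronglyMeasurable (fun s => f (s, y)) μ := hfs.1.prodMk_left
  have h5 : ∀ᵐ y ∂ν, MemLp (fun s => f (s, y)) 2 μ := by
    filter_upwards [h3, h4] with y hy hy'
    exact (memLp_two_iff_integrable_sq_norm hy').2 hy
  filter_upwards [Measure.quasiMeasurePreserving_snd.ae h5] with z hz
  have : Integrable (fun s => conj (φ s) * f (s, z.2)) μ :=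
    MemLp.integrable_mul (p := 2) (q := 2) hφ.star hz
  simpa only [mul_assoc] using this.const_mul (φ z.1)

theorem projFun₂_eq (ψ : β → ℂ) (f : α × β → ℂ) :
    projFun₂ (α := α) ν ψ f = fun z => projFun₁ ν ψ (fun w : β × α => f w.swap) z.swap := rfl

theorem memLp_projFun₂ {ψ : β → ℂ} {f : α × β → ℂ}
    (hψ : MemLp ψ 2 ν) (hf : MemLp f 2 (μ.prod ν)) :
    MemLp (projFun₂ (α := α) ν ψ f) 2 (μ.prod ν) := by
  have hfs : MemLp (fun w : β × α => f w.swap) 2 (ν.prod μ) :=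
    hf.comp_measurePreserving Measure.measurePreserving_swap
  exact (memLp_projFun₁ hψ hfs).comp_measurePreserving Measure.measurePreserving_swap

theorem eLpNorm_projFun₂_le {ψ : β → ℂ} {f : α × β → ℂ}
    (hψ : MemLp ψ 2 ν) (hf : MemLp f 2 (μ.prod ν)) :
    eLpNorm (projFun₂ (α := α) ν ψ f) 2 (μ.prod ν) ≤
      eLpNorm ψ 2 ν * eLpNorm ψ 2 ν * eLpNorm f 2 (μ.prod ν) := by
  have hsw : MeasurePreserving (Prod.swap : α × β → β × α) (μ.prod ν) (ν.prod μ) :=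
    Measure.measurePreserving_swap
  have hsw' : MeasurePreserving (Prod.swap : β × α → α × β) (ν.prod μ) (μ.prod ν) :=
    Measure.measurePreserving_swap
  have hfs : MemLp (f ∘ Prod.swap) 2 (ν.prod μ) := hf.comp_measurePreserving hsw'
  have h1 := eLpNorm_projFun₁_le hψ.1 hfs.1
  have h2 := eLpNorm_comp_measurePreserving (p := 2) hf.1 hsw'
  have h3 := eLpNorm_comp_measurePreserving (p := 2) (memLp_projFun₁ hψ hfs).1 hsw
  rw [h2, ← h3] at h1
  exact h1

theorem projFun₂_congr {ψ : β → ℂ} {f g : α × β → ℂ} (h : f =ᵐ[μ.prod ν] g) :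
    projFun₂ (α := α) ν ψ f =ᵐ[μ.prod ν] projFun₂ (α := α) ν ψ g := by
  filter_upwards [ae_section_fst h] with z hz
  refine integral_congr_ae ?_
  filter_upwards [hz] with s hs
  rw [hs]

theorem ae_integrable_section₂ {ψ : β → ℂ} {f : α × β → ℂ}
    (hψ : MemLp ψ 2 ν) (hf : MemLp f 2 (μ.prod ν)) :
    ∀ᵐ z ∂(μ.prod ν), Integrable (fun t => ψ z.2 * conj (ψ t) * f (z.1, t)) ν := by
  have hfs : MemLp (fun w : β × α => f w.swap) 2 (ν.prod μ) :=
    hf.comp_measurePreserving Measure.measurePreserving_swap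
  exact Measure.measurePreserving_swap.quasiMeasurePreserving.ae (ae_integrable_section₁ hψ hfs)

/-- A linear map of `L²` from a pointwise formula `F` that is compatible with a.e. equality,
square integrable, a.e. linear and bounded. -/
def ofFormula {γ : Type*} [MeasurableSpace γ] {ρ : Measure γ} (F : (γ → ℂ) → γ → ℂ)
    (hF : ∀ f : Lp ℂ 2 ρ, MemLp (F f) 2 ρ)
    (hadd : ∀ f g : Lp ℂ 2 ρ, F ⇑(f + g) =ᵐ[ρ] F f + F g)
    (hsmul : ∀ (c : ℂ) (f : Lp ℂ 2 ρ), F ⇑(c • f) =ᵐ[ρ] c • F f)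
    (C : ℝ≥0∞) (hC : C ≠ ∞) (hb : ∀ f : Lp ℂ 2 ρ, eLpNorm (F f) 2 ρ ≤ C * eLpNorm f 2 ρ) :
    Lp ℂ 2 ρ →L[ℂ] Lp ℂ 2 ρ :=
  LinearMap.mkContinuous
    { toFun := fun f => (hF f).toLp (F f)
      map_add' := fun f g => by
        rw [← MemLp.toLp_add, MemLp.toLp_eq_toLp_iff]
        exact hadd f g
      map_smul' := fun c f => by
        rw [RingHom.id_apply, ← MemLp.toLp_const_smul, MemLp.toLp_eq_toLp_iff]
        exact hsmul c f }
    C.toReal (fun f => by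
      change ‖(hF f).toLp (F f)‖ ≤ _
      rw [Lp.norm_toLp, Lp.norm_def, ← ENNReal.toReal_mul]
      exact ENNReal.toReal_mono (ENNReal.mul_ne_top hC (Lp.eLpNorm_ne_top f)) (hb f))

theorem coeFn_ofFormula {γ : Type*} [MeasurableSpace γ] {ρ : Measure γ} (F : (γ → ℂ) → γ → ℂ)
    (hF : ∀ f : Lp ℂ 2 ρ, MemLp (F f) 2 ρ)
    (hadd : ∀ f g : Lp ℂ 2 ρ, F ⇑(f + g) =ᵐ[ρ] F f + F g)
    (hsmul : ∀ (c : ℂ) (f : Lp ℂ 2 ρ), F ⇑(c • f) =ᵐ[ρ] c • F f)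
    (C : ℝ≥0∞) (hC : C ≠ ∞) (hb : ∀ f : Lp ℂ 2 ρ, eLpNorm (F f) 2 ρ ≤ C * eLpNorm f 2 ρ)
    (f : Lp ℂ 2 ρ) : ofFormula F hF hadd hsmul C hC hb f =ᵐ[ρ] F f :=
  MemLp.coeFn_toLp (hF f)

/-- `(P_φ f)(x, y) = ∫ φ(x) * conj φ(s) * f(s, y) dμ(s)` as a bounded operator on `L²`. -/
def P (φ : Lp ℂ 2 μ) : Lp ℂ 2 (μ.prod ν) →L[ℂ] Lp ℂ 2 (μ.prod ν) :=
  ofFormula (projFun₁ μ φ)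
    (fun f => memLp_projFun₁ (Lp.memLp φ) (Lp.memLp f))
    (fun f g => by
      refine (projFun₁_congr (Lp.coeFn_add f g)).trans ?_
      filter_upwards [ae_integrable_section₁ (Lp.memLp φ) (Lp.memLp f),
        ae_integrable_section₁ (Lp.memLp φ) (Lp.memLp g)] with z h1 h2
      simp only [projFun₁, Pi.add_apply, mul_add]
      exact integral_add h1 h2)
    (fun c f => by
      refine (projFun₁_congr (Lp.coeFn_smul c f)).trans (Filter.Eventually.of_forall fun z => ?_)
      simp only [projFun₁, Pi.smul_apply, smul_eq_mul]
      rw [← integral_const_mul]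
      congr 1
      funext s
      ring)
    (eLpNorm φ 2 μ * eLpNorm φ 2 μ)
    (ENNReal.mul_ne_top (Lp.eLpNorm_ne_top φ) (Lp.eLpNorm_ne_top φ))
    (fun f => eLpNorm_projFun₁_le (Lp.aestronglyMeasurable φ) (Lp.aestronglyMeasurable f))

theorem coeFn_P (φ : Lp ℂ 2 μ) (f : Lp ℂ 2 (μ.prod ν)) :
    P φ f =ᵐ[μ.prod ν] projFun₁ μ φ f :=
  coeFn_ofFormula ..

/-- `(Q_ψ f)(x, y) = ∫ ψ(y) * conj ψ(t) * f(x, t) dν(t)` as a bounded operator on `L²`. -/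
def Q (ψ : Lp ℂ 2 ν) : Lp ℂ 2 (μ.prod ν) →L[ℂ] Lp ℂ 2 (μ.prod ν) :=
  ofFormula (projFun₂ ν ψ)
    (fun f => memLp_projFun₂ (Lp.memLp ψ) (Lp.memLp f))
    (fun f g => by
      refine (projFun₂_congr (Lp.coeFn_add f g)).trans ?_
      filter_upwards [ae_integrable_section₂ (Lp.memLp ψ) (Lp.memLp f),
        ae_integrable_section₂ (Lp.memLp ψ) (Lp.memLp g)] with z h1 h2
      simp only [projFun₂, Pi.add_apply, mul_add]
      exact integral_add h1 h2)
    (fun c f => by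
      refine (projFun₂_congr (Lp.coeFn_smul c f)).trans (Filter.Eventually.of_forall fun z => ?_)
      simp only [projFun₂, Pi.smul_apply, smul_eq_mul]
      rw [← integral_const_mul]
      congr 1
      funext s
      ring)
    (eLpNorm ψ 2 ν * eLpNorm ψ 2 ν)
    (ENNReal.mul_ne_top (Lp.eLpNorm_ne_top ψ) (Lp.eLpNorm_ne_top ψ))
    (fun f => eLpNorm_projFun₂_le (Lp.memLp ψ) (Lp.memLp f))

theorem coeFn_Q (ψ : Lp ℂ 2 ν) (f : Lp ℂ 2 (μ.prod ν)) :
    Q ψ f =ᵐ[μ.prod ν] projFun₂ ν ψ f :=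
  coeFn_ofFormula ..

/-! ### Multiplication operators -/

theorem eLpNorm_mul_top_le {γ : Type*} [MeasurableSpace γ] {ρ : Measure γ} {g f : γ → ℂ}
    (hg : MemLp g ∞ ρ) (hf : MemLp f 2 ρ) :
    eLpNorm (fun z => g z * f z) 2 ρ ≤ eLpNorm g ∞ ρ * eLpNorm f 2 ρ :=
  eLpNorm_smul_le_eLpNorm_top_mul_eLpNorm 2 hf.1 g

open Classical in
/-- Multiplication by `g` on `L²`, for an essentially bounded `g` (and `0` for any other `g`). -/
def mulOp {γ : Type*} [MeasurableSpace γ] (ρ : Measure γ) (g : γ → ℂ) :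
    Lp ℂ 2 ρ →L[ℂ] Lp ℂ 2 ρ :=
  if hg : MemLp g ∞ ρ then
    ofFormula (fun f z => g z * f z)
      (fun f => (Lp.memLp f).mul' hg)
      (fun f₁ f₂ => by
        filter_upwards [Lp.coeFn_add f₁ f₂] with z hz
        simp only [hz, Pi.add_apply, mul_add])
      (fun c f => by
        filter_upwards [Lp.coeFn_smul c f] with z hz
        simp only [hz, Pi.smul_apply, smul_eq_mul]
        ring)
      (eLpNorm g ∞ ρ) hg.2.ne (fun f => eLpNorm_mul_top_le hg (Lp.memLp f))
  else 0

theorem coeFn_mulOp {γ : Type*} [MeasurableSpace γ] {ρ : Measure γ} {g : γ → ℂ}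
    (hg : MemLp g ∞ ρ) (f : Lp ℂ 2 ρ) : mulOp ρ g f =ᵐ[ρ] fun z => g z * f z := by
  rw [mulOp, dif_pos hg]
  exact coeFn_ofFormula ..

theorem memLp_ofReal_snd (h : Lp ℝ ∞ ν) :
    MemLp (fun z : α × β => ((h z.2 : ℝ) : ℂ)) ∞ (μ.prod ν) := by
  have hm : MemLp (fun x => ((h x : ℝ) : ℂ)) ∞ ν := (Lp.memLp h).ofReal
  refine ⟨hm.1.comp_snd, lt_of_le_of_lt ?_ hm.2⟩
  rw [eLpNorm_exponent_top, eLpNorm_exponent_top]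
  exact essSup_le_of_ae_le _ (Measure.quasiMeasurePreserving_snd.ae ae_le_eLpNormEssSup)

theorem memLp_ofReal_fst (p : Lp ℝ ∞ μ) :
    MemLp (fun z : α × β => ((p z.1 : ℝ) : ℂ)) ∞ (μ.prod ν) := by
  have hm : MemLp (fun x => ((p x : ℝ) : ℂ)) ∞ μ := (Lp.memLp p).ofReal
  refine ⟨hm.1.comp_fst, lt_of_le_of_lt ?_ hm.2⟩
  rw [eLpNorm_exponent_top, eLpNorm_exponent_top]
  exact essSup_le_of_ae_le _ (Measure.quasiMeasurePreserving_fst.ae ae_le_eLpNormEssSup)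

/-! ### The partial integral operators with degenerate kernels -/

section Operators

variable {n m : ℕ}

/-- `k₁(x, s, y) = ∑ₖ φₖ(x) * conj φₖ(s) * hₖ(y)`. -/
def kernel₁ (φ : Fin n → Lp ℂ 2 μ) (h : Fin n → Lp ℝ ∞ ν) (x s : α) (y : β) : ℂ :=
  ∑ k, φ k x * conj (φ k s) * ((h k y : ℝ) : ℂ)

/-- `k₂(x, t, y) = ∑ⱼ pⱼ(x) * ψⱼ(y) * conj ψⱼ(t)`. -/
def kernel₂ (ψ : Fin m → Lp ℂ 2 ν) (p : Fin m → Lp ℝ ∞ μ) (x : α) (t y : β) : ℂ :=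
  ∑ j, ((p j x : ℝ) : ℂ) * ψ j y * conj (ψ j t)

/-- `(T₁ f)(x, y) = ∫ k₁(x, s, y) f(s, y) dμ(s)`, pointwise. -/
def T₁Fun (φ : Fin n → Lp ℂ 2 μ) (h : Fin n → Lp ℝ ∞ ν) (f : α × β → ℂ) (z : α × β) : ℂ :=
  ∫ s, kernel₁ φ h z.1 s z.2 * f (s, z.2) ∂μ

/-- `(T₂ f)(x, y) = ∫ k₂(x, t, y) f(x, t) dν(t)`, pointwise. -/
def T₂Fun (ψ : Fin m → Lp ℂ 2 ν) (p : Fin m → Lp ℝ ∞ μ) (f : α × β → ℂ) (z : α × β) : ℂ :=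
  ∫ t, kernel₂ ψ p z.1 t z.2 * f (z.1, t) ∂ν

theorem coeFn_sum_ae {γ ι : Type*} [MeasurableSpace γ] {ρ : Measure γ} (s : Finset ι)
    (F : ι → Lp ℂ 2 ρ) : ⇑(∑ i ∈ s, F i) =ᵐ[ρ] fun z => ∑ i ∈ s, F i z := by
  classical
  induction s using Finset.induction_on with
  | empty =>
    simp only [Finset.sum_empty]
    exact Lp.coeFn_zero ℂ 2 ρ
  | insert a s ha ih =>
    rw [Finset.sum_insert ha]
    filter_upwards [Lp.coeFn_add (F a) (∑ i ∈ s, F i), ih] with z h1 h2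
    rw [h1, Pi.add_apply, h2, Finset.sum_insert ha]

theorem T₁Fun_ae (φ : Fin n → Lp ℂ 2 μ) (h : Fin n → Lp ℝ ∞ ν) (f : Lp ℂ 2 (μ.prod ν)) :
    ⇑((∑ k, mulOp (μ.prod ν) (fun z => ((h k z.2 : ℝ) : ℂ)) ∘L P (φ k)) f)
      =ᵐ[μ.prod ν] T₁Fun φ h f := by
  rw [_root_.sum_apply]
  refine (coeFn_sum_ae _ _).trans ?_
  have h1 := ae_all_iff.2 fun k => coeFn_mulOp (memLp_ofReal_snd (μ := μ) (h k)) (P (φ k) f)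
  have h2 := ae_all_iff.2 fun k => coeFn_P (φ k) f
  have h3 := ae_all_iff.2 fun k => ae_integrable_section₁ (Lp.memLp (φ k)) (Lp.memLp f)
  filter_upwards [h1, h2, h3] with z h1 h2 h3
  simp only [T₁Fun, kernel₁, Finset.sum_mul]
  rw [integral_finsetSum]
  · refine Finset.sum_congr rfl fun k _ => ?_
    rw [ContinuousLinearMap.comp_apply, h1 k, h2 k, projFun₁, ← integral_const_mul]
    congr 1
    funext s
    ring
  · intro k _
    refine ((h3 k).const_mul ((h k z.2 : ℝ) : ℂ)).congr (Filter.Eventually.of_forall fun s => ?_)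
    simp only
    ring

theorem T₂Fun_ae (ψ : Fin m → Lp ℂ 2 ν) (p : Fin m → Lp ℝ ∞ μ) (f : Lp ℂ 2 (μ.prod ν)) :
    ⇑((∑ j, mulOp (μ.prod ν) (fun z => ((p j z.1 : ℝ) : ℂ)) ∘L Q (ψ j)) f)
      =ᵐ[μ.prod ν] T₂Fun ψ p f := by
  rw [_root_.sum_apply]
  refine (coeFn_sum_ae _ _).trans ?_
  have h1 := ae_all_iff.2 fun j => coeFn_mulOp (memLp_ofReal_fst (ν := ν) (p j)) (Q (ψ j) f)
  have h2 := ae_all_iff.2 fun j => coeFn_Q (ψ j) f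
  have h3 := ae_all_iff.2 fun j => ae_integrable_section₂ (Lp.memLp (ψ j)) (Lp.memLp f)
  filter_upwards [h1, h2, h3] with z h1 h2 h3
  simp only [T₂Fun, kernel₂, Finset.sum_mul]
  rw [integral_finsetSum]
  · refine Finset.sum_congr rfl fun j _ => ?_
    rw [ContinuousLinearMap.comp_apply, h1 j, h2 j, projFun₂, ← integral_const_mul]
    congr 1
    funext s
    ring
  · intro j _
    refine ((h3 j).const_mul ((p j z.1 : ℝ) : ℂ)).congr (Filter.Eventually.of_forall fun s => ?_)
    simp only
    ring

theorem memLp_T₁Fun (φ : Fin n → Lp ℂ 2 μ) (h : Fin n → Lp ℝ ∞ ν) (f : Lp ℂ 2 (μ.prod ν)) :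
    MemLp (T₁Fun φ h f) 2 (μ.prod ν) :=
  (memLp_congr_ae (T₁Fun_ae φ h f)).1 (Lp.memLp _)

theorem memLp_T₂Fun (ψ : Fin m → Lp ℂ 2 ν) (p : Fin m → Lp ℝ ∞ μ) (f : Lp ℂ 2 (μ.prod ν)) :
    MemLp (T₂Fun ψ p f) 2 (μ.prod ν) :=
  (memLp_congr_ae (T₂Fun_ae ψ p f)).1 (Lp.memLp _)

/-- The operator `(T₁ f)(x, y) = ∫ k₁(x, s, y) f(s, y) dμ(s)` on `L²(μ × ν)`. -/
def T₁ (φ : Fin n → Lp ℂ 2 μ) (h : Fin n → Lp ℝ ∞ ν) :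
    Lp ℂ 2 (μ.prod ν) →L[ℂ] Lp ℂ 2 (μ.prod ν) :=
  (∑ k, mulOp (μ.prod ν) (fun z => ((h k z.2 : ℝ) : ℂ)) ∘L P (φ k)).copy
    (fun f => (memLp_T₁Fun φ h f).toLp (T₁Fun φ h f))
    (funext fun f => Lp.ext ((MemLp.coeFn_toLp _).trans (T₁Fun_ae φ h f).symm))

/-- The operator `(T₂ f)(x, y) = ∫ k₂(x, t, y) f(x, t) dν(t)` on `L²(μ × ν)`. -/
def T₂ (ψ : Fin m → Lp ℂ 2 ν) (p : Fin m → Lp ℝ ∞ μ) :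
    Lp ℂ 2 (μ.prod ν) →L[ℂ] Lp ℂ 2 (μ.prod ν) :=
  (∑ j, mulOp (μ.prod ν) (fun z => ((p j z.1 : ℝ) : ℂ)) ∘L Q (ψ j)).copy
    (fun f => (memLp_T₂Fun ψ p f).toLp (T₂Fun ψ p f))
    (funext fun f => Lp.ext ((MemLp.coeFn_toLp _).trans (T₂Fun_ae ψ p f).symm))

theorem coeFn_T₁ (φ : Fin n → Lp ℂ 2 μ) (h : Fin n → Lp ℝ ∞ ν) (f : Lp ℂ 2 (μ.prod ν)) :
    T₁ φ h f =ᵐ[μ.prod ν] fun z => ∫ s, kernel₁ φ h z.1 s z.2 * f (s, z.2) ∂μ :=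
  MemLp.coeFn_toLp (memLp_T₁Fun φ h f)

theorem coeFn_T₂ (ψ : Fin m → Lp ℂ 2 ν) (p : Fin m → Lp ℝ ∞ μ) (f : Lp ℂ 2 (μ.prod ν)) :
    T₂ ψ p f =ᵐ[μ.prod ν] fun z => ∫ t, kernel₂ ψ p z.1 t z.2 * f (z.1, t) ∂ν :=
  MemLp.coeFn_toLp (memLp_T₂Fun ψ p f)

/-- `(S₁(τ) f)(x, y) = ∑ₖ hₖ(y) / (1 - τ hₖ(y)) * (Pₖ f)(x, y)`. The multipliers are essentially
bounded whenever `τ ≠ 0` and `τ⁻¹` lies in the resolvent set of `T₁`. -/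
def S₁ (φ : Fin n → Lp ℂ 2 μ) (h : Fin n → Lp ℝ ∞ ν) (τ : ℂ) :
    Lp ℂ 2 (μ.prod ν) →L[ℂ] Lp ℂ 2 (μ.prod ν) :=
  ∑ k, mulOp (μ.prod ν) (fun z => ((h k z.2 : ℝ) : ℂ) / (1 - τ * ((h k z.2 : ℝ) : ℂ)))
    ∘L P (φ k)

/-- `W₁(τ) = (E - τ T₂)⁻¹ S₁(τ) T₂`, for `τ ≠ 0` with `τ⁻¹` in both resolvent sets. -/
def W₁ (φ : Fin n → Lp ℂ 2 μ) (h : Fin n → Lp ℝ ∞ ν)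
    (ψ : Fin m → Lp ℂ 2 ν) (p : Fin m → Lp ℝ ∞ μ) (τ : ℂ) :
    Lp ℂ 2 (μ.prod ν) →L[ℂ] Lp ℂ 2 (μ.prod ν) :=
  Ring.inverse (1 - τ • T₂ ψ p) * S₁ φ h τ * T₂ ψ p

end Operators

end General

/-! ### Fredholm determinant and discrete spectrum -/

/-- The Fredholm determinant `det (E - A)` of a finite-rank operator `A`: the determinant of the
restriction of `E - A` to the (finite-dimensional, invariant) range of `A`. -/
def fredholmDet {H : Type*} [NormedAddCommGroup H] [NormedSpace ℂ H] (A : H →L[ℂ] H) : ℂ :=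
  LinearMap.det
    (LinearMap.id - (A : H →ₗ[ℂ] H).rangeRestrict ∘ₗ (LinearMap.range (A : H →ₗ[ℂ] H)).subtype)

/-- The discrete spectrum of a bounded self-adjoint operator: the isolated points of the spectrum
that are eigenvalues of finite multiplicity. -/
def discreteSpectrum {H : Type*} [NormedAddCommGroup H] [NormedSpace ℂ H] (A : H →L[ℂ] H) :
    Set ℂ :=
  {z | (∃ ε > 0, spectrum ℂ A ∩ Metric.ball z ε = {z}) ∧
    Module.End.HasEigenvalue (A : H →ₗ[ℂ] H) z ∧
    FiniteDimensional ℂ (Module.End.eigenspace (A : H →ₗ[ℂ] H) z)}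

section Main

variable {α β : Type*} [MeasurableSpace α] [MeasurableSpace β] {μ : Measure α} {ν : Measure β}
  [SFinite μ] [SFinite ν] {n m : ℕ}

/-- `𝒟(T)`: the `τ ≠ 0` with `τ⁻¹ ∈ ρ(T₁) ∩ ρ(T₂)` at which the Fredholm determinant
`Δ₁(τ) = det (E - τ² W₁(τ))` vanishes. -/
def D (φ : Fin n → Lp ℂ 2 μ) (h : Fin n → Lp ℝ ∞ ν)
    (ψ : Fin m → Lp ℂ 2 ν) (p : Fin m → Lp ℝ ∞ μ) : Set ℂ :=
  {τ | τ ≠ 0 ∧ τ⁻¹ ∈ resolventSet ℂ (T₁ φ h) ∩ resolventSet ℂ (T₂ ψ p) ∧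
    fredholmDet (τ ^ 2 • W₁ φ h ψ p τ) = 0}

/-- `𝒟₀(T) = {1 / τ : τ ∈ 𝒟(T)}`. -/
def D₀ (φ : Fin n → Lp ℂ 2 μ) (h : Fin n → Lp ℝ ∞ ν)
    (ψ : Fin m → Lp ℂ 2 ν) (p : Fin m → Lp ℝ ∞ μ) : Set ℂ :=
  {ξ | ∃ τ ∈ D φ h ψ p, ξ = 1 / τ}

/-- `G = ℂ ∖ (σ(T₁) ∪ σ(T₂))`. -/
def G (φ : Fin n → Lp ℂ 2 μ) (h : Fin n → Lp ℝ ∞ ν)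
    (ψ : Fin m → Lp ℂ 2 ν) (p : Fin m → Lp ℝ ∞ μ) : Set ℂ :=
  (spectrum ℂ (T₁ φ h) ∪ spectrum ℂ (T₂ ψ p))ᶜ

/-- The functions `F_{k,j}(x, y; λ)` of the degenerate kernel
`λ ∑_{j,k} F_{k,j}(x, y; λ) B_{k,j}(s, t)` of `W₁(1/λ)`. -/
def F (φ : Fin n → Lp ℂ 2 μ) (h : Fin n → Lp ℝ ∞ ν)
    (ψ : Fin m → Lp ℂ 2 ν) (p : Fin m → Lp ℝ ∞ μ) (l : ℂ) (ω : Fin m × Fin n)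
    (z : α × β) : ℂ :=
  φ ω.2 z.1 * (ψ ω.1 z.2 * ((h ω.2 z.2 : ℝ) : ℂ) / (l - ((h ω.2 z.2 : ℝ) : ℂ)) +
    ∑ i, ((p i z.1 : ℝ) : ℂ) * ψ i z.2 / (l - ((p i z.1 : ℝ) : ℂ)) *
      ∫ ξ, ((h ω.2 ξ : ℝ) : ℂ) / (l - ((h ω.2 ξ : ℝ) : ℂ)) * ψ ω.1 ξ * conj (ψ i ξ) ∂ν)

/-- The functions `B_{k,j}(s, t) = p_k(s) * conj φ_j(s) * conj ψ_k(t)`. -/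
def B (φ : Fin n → Lp ℂ 2 μ) (ψ : Fin m → Lp ℂ 2 ν) (p : Fin m → Lp ℝ ∞ μ)
    (ω : Fin m × Fin n) (z : α × β) : ℂ :=
  ((p ω.1 z.1 : ℝ) : ℂ) * conj (φ ω.2 z.1) * conj (ψ ω.1 z.2)

/-- The matrix `Π(λ)` with entries `∫∫ F_ω(x, y; λ) B_ω'(x, y) dμ(x) dν(y)`, indexed by the pairs
`ω = (k, j)`; the determinant of `Π(λ) - λ I` does not depend on how the pairs are ordered. -/
def PiMatrix (φ : Fin n → Lp ℂ 2 μ) (h : Fin n → Lp ℝ ∞ ν)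
    (ψ : Fin m → Lp ℂ 2 ν) (p : Fin m → Lp ℝ ∞ μ) (l : ℂ) :
    Matrix (Fin m × Fin n) (Fin m × Fin n) ℂ :=
  Matrix.of fun ω ω' => ∫ z, F φ h ψ p l ω z * B φ ψ p ω' z ∂(μ.prod ν)

/-- `Δ(λ) = det (Π(λ) - λ I)`. -/
def Delta (φ : Fin n → Lp ℂ 2 μ) (h : Fin n → Lp ℝ ∞ ν)
    (ψ : Fin m → Lp ℂ 2 ν) (p : Fin m → Lp ℝ ∞ μ) (l : ℂ) : ℂ :=
  (PiMatrix φ h ψ p l - l • (1 : Matrix (Fin m × Fin n) (Fin m × Fin n) ℂ)).det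

end Main

end PartialInt

end

/-! Call `l` regular if it is nonzero and at positive distance from the essential ranges of all `h
k` and `p j`. At a regular `l` both `1 - l⁻¹ T₁` and `1 - l⁻¹ T₂` are invertible, with inverses `1 +
l⁻¹ S₁` and `1 + l⁻¹ S₂`, and since `(1 - l⁻¹ T₁) S₁ = T₁`, `T - l = -l (1 - l⁻¹ T₁) (1 - l⁻¹ T₂) (1
- l⁻² W₁(l⁻¹))` (`exists_factorization`). The operator `S₁ T₂` has rank at most `mn`, because its
two factors integrate out one variable each. Hence `T - l` is an invertible operator times `1 - K`
with `K` of finite rank. Eigenvectors of `T` for `l` are the fixed vectors of `K`; these exist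
exactly when the Fredholm determinant vanishes, and, in coordinates, exactly when `Delta` does
(`fredholmDet_W₁_eq_zero_iff`). Such an `l` is automatically isolated of finite multiplicity, by
self-adjointness and the Fredholm alternative (`mem_discreteSpectrum_of_isUnit_mul`).

It remains to see that nothing is lost outside the regular points. If `l` is not regular, there are
approximate eigenvectors of one of the `Tᵢ` which the other one annihilates, subject to any finite
number of further linear conditions (`exists_approx_of_isPartial`). So `l` is in the spectrum of
that `Tᵢ`, which identifies `G` with the regular points (`mem_G_iff`). They are approximate
eigenvectors of `T` too, and can be taken orthogonal to a finite-dimensional eigenspace, so `l` is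
not in the discrete spectrum (`regular_of_mem_discreteSpectrum`). -/

noncomputable section

namespace PartialInt

/-! ### Product functions in `L²` and the operators acting on them -/

section Tensor

variable {α β : Type*} [MeasurableSpace α] [MeasurableSpace β] {μ : Measure α} {ν : Measure β}
  [IsFiniteMeasure μ] [IsFiniteMeasure ν]

theorem memLp_mul_prod (f : Lp ℂ 2 μ) (g : Lp ℂ 2 ν) :
    MemLp (fun z : α × β => f z.1 * g z.2) 2 (μ.prod ν) := by
  have hm : AEStronglyMeasurable (fun z : α × β => f z.1 * g z.2) (μ.prod ν) :=
    (Lp.aestronglyMeasurable f).comp_fst.mul (Lp.aestronglyMeasurable g).comp_snd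
  rw [memLp_two_iff_integrable_sq_norm hm]
  simp only [norm_mul, mul_pow]
  exact ((Lp.memLp f).integrable_norm_pow two_ne_zero).mul_prod
    ((Lp.memLp g).integrable_norm_pow two_ne_zero)

/-- The square integrable function `(x, y) ↦ f x * g y`. -/
def tensFun (f : Lp ℂ 2 μ) (g : Lp ℂ 2 ν) : Lp ℂ 2 (μ.prod ν) :=
  (memLp_mul_prod f g).toLp _

theorem coeFn_tensFun (f : Lp ℂ 2 μ) (g : Lp ℂ 2 ν) :
    tensFun f g =ᵐ[μ.prod ν] fun z => f z.1 * g z.2 :=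
  MemLp.coeFn_toLp _

theorem ae_fst {q : α → Prop} (h : ∀ᵐ x ∂μ, q x) : ∀ᵐ z ∂(μ.prod ν), q z.1 :=
  Measure.quasiMeasurePreserving_fst.ae h

theorem ae_snd {q : β → Prop} (h : ∀ᵐ y ∂ν, q y) : ∀ᵐ z ∂(μ.prod ν), q z.2 :=
  Measure.quasiMeasurePreserving_snd.ae h

/-- The bilinear map `(f, g) ↦ ((x, y) ↦ f x * g y)`. -/
def tens : Lp ℂ 2 μ →ₗ[ℂ] Lp ℂ 2 ν →ₗ[ℂ] Lp ℂ 2 (μ.prod ν) :=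
  LinearMap.mk₂ ℂ tensFun
    (fun f f' g => by
      refine Lp.ext ?_
      filter_upwards [coeFn_tensFun (f + f') g, coeFn_tensFun f g, coeFn_tensFun f' g,
        Lp.coeFn_add (tensFun f g) (tensFun f' g), ae_fst (ν := ν) (Lp.coeFn_add f f')]
        with z h1 h2 h3 h4 h5
      rw [h1, h4, Pi.add_apply, h2, h3, h5, Pi.add_apply, add_mul])
    (fun c f g => by
      refine Lp.ext ?_
      filter_upwards [coeFn_tensFun (c • f) g, coeFn_tensFun f g,
        Lp.coeFn_smul c (tensFun f g), ae_fst (ν := ν) (Lp.coeFn_smul c f)] with z h1 h2 h4 h5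
      rw [h1, h4, Pi.smul_apply, h2, h5, Pi.smul_apply, smul_eq_mul, smul_eq_mul, mul_assoc])
    (fun f g g' => by
      refine Lp.ext ?_
      filter_upwards [coeFn_tensFun f (g + g'), coeFn_tensFun f g, coeFn_tensFun f g',
        Lp.coeFn_add (tensFun f g) (tensFun f g'), ae_snd (μ := μ) (Lp.coeFn_add g g')]
        with z h1 h2 h3 h4 h5
      rw [h1, h4, Pi.add_apply, h2, h3, h5, Pi.add_apply, mul_add])
    (fun c f g => by
      refine Lp.ext ?_
      filter_upwards [coeFn_tensFun f (c • g), coeFn_tensFun f g,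
        Lp.coeFn_smul c (tensFun f g), ae_snd (μ := μ) (Lp.coeFn_smul c g)] with z h1 h2 h4 h5
      rw [h1, h4, Pi.smul_apply, h2, h5, Pi.smul_apply, smul_eq_mul, smul_eq_mul,
        mul_left_comm])

theorem coeFn_tens (f : Lp ℂ 2 μ) (g : Lp ℂ 2 ν) :
    tens f g =ᵐ[μ.prod ν] fun z => f z.1 * g z.2 :=
  coeFn_tensFun f g

theorem inner_tens (f f' : Lp ℂ 2 μ) (g g' : Lp ℂ 2 ν) :
    inner ℂ (tens f g) (tens f' g') = inner ℂ f f' * inner ℂ g g' := by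
  rw [L2.inner_def, L2.inner_def, L2.inner_def, ← integral_prod_mul]
  refine integral_congr_ae ?_
  filter_upwards [coeFn_tens f g, coeFn_tens f' g'] with z h1 h2
  rw [h1, h2]
  simp only [RCLike.inner_apply, map_mul]
  ring

/-- Indicators of measurable rectangles are product functions, so `u` integrates to zero over
rectangles. Rectangles form a π-system generating the product σ-algebra, so `u` integrates to zero
over every measurable set. Finiteness of the measures puts the indicators in `L²` and makes `u`
integrable. -/
theorem eq_zero_of_inner_tens (u : Lp ℂ 2 (μ.prod ν))
    (hu : ∀ (f : Lp ℂ 2 μ) (g : Lp ℂ 2 ν), inner ℂ (tens f g) u = 0) : u = 0 := by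
  have hint : Integrable u (μ.prod ν) := (Lp.memLp u).integrable one_le_two
  have key : ∀ s, MeasurableSet s → ∫ z in s, u z ∂(μ.prod ν) = 0 := by
    have hrect : ∀ (A : Set α) (C : Set β), MeasurableSet A → MeasurableSet C →
        ∫ z in A ×ˢ C, u z ∂(μ.prod ν) = 0 := by
      intro A C hA hC
      have h0 := hu (indicatorConstLp 2 hA (measure_ne_top μ A) (1 : ℂ))
        (indicatorConstLp 2 hC (measure_ne_top ν C) (1 : ℂ))
      rw [L2.inner_def] at h0
      rw [← h0, ← integral_indicator (hA.prod hC)]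
      refine integral_congr_ae ?_
      filter_upwards [coeFn_tens (indicatorConstLp 2 hA (measure_ne_top μ A) (1 : ℂ))
        (indicatorConstLp 2 hC (measure_ne_top ν C) (1 : ℂ)),
        ae_fst (ν := ν) (indicatorConstLp_coeFn (p := 2) (hs := hA) (hμs := measure_ne_top μ A)
          (c := (1 : ℂ))),
        ae_snd (μ := μ) (indicatorConstLp_coeFn (p := 2) (hs := hC) (hμs := measure_ne_top ν C)
          (c := (1 : ℂ)))] with z h1 h2 h3
      rw [h1, h2, h3]
      by_cases ha : z.1 ∈ A <;> by_cases hc : z.2 ∈ C <;> simp [indicator, ha, hc]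
    intro s hs
    induction s, hs using MeasurableSpace.induction_on_inter generateFrom_prod.symm
      isPiSystem_prod with
    | empty => simp
    | basic t ht =>
      obtain ⟨A, hA, C, hC, rfl⟩ := ht
      exact hrect A C hA hC
    | compl t ht ih =>
      -- The whole space is itself a rectangle, so the total integral vanishes and complements are
      -- covered.
      have h1 := integral_add_compl ht hint
      have h2 := hrect univ univ .univ .univ
      rw [univ_prod_univ, setIntegral_univ] at h2
      rwa [ih, h2, zero_add] at h1
    | iUnion t hd ht ih =>
      rw [integral_iUnion ht hd hint.integrableOn]
      simp [ih]
  refine Lp.ext ((hint.ae_eq_zero_of_forall_setIntegral_eq_zero fun s hs _ => key s hs).trans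
    (Lp.coeFn_zero ℂ 2 (μ.prod ν)).symm)

/-! ### The basic operators on product functions -/

theorem P_tens (φ f : Lp ℂ 2 μ) (g : Lp ℂ 2 ν) :
    P φ (tens f g) = (inner ℂ φ f : ℂ) • tens φ g := by
  refine Lp.ext ?_
  refine (coeFn_P φ (tens f g)).trans ((projFun₁_congr (coeFn_tens f g)).trans ?_)
  filter_upwards [Lp.coeFn_smul (inner ℂ φ f : ℂ) (tens φ g), coeFn_tens φ g] with z h1 h2
  rw [h1, Pi.smul_apply, h2, L2.inner_def, projFun₁, smul_eq_mul, ← integral_mul_const]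
  refine integral_congr_ae (Filter.Eventually.of_forall fun s => ?_)
  simp only [RCLike.inner_apply]
  ring

theorem Q_tens (ψ g : Lp ℂ 2 ν) (f : Lp ℂ 2 μ) :
    Q ψ (tens f g) = (inner ℂ ψ g : ℂ) • tens f ψ := by
  refine Lp.ext ?_
  refine (coeFn_Q ψ (tens f g)).trans ((projFun₂_congr (coeFn_tens f g)).trans ?_)
  filter_upwards [Lp.coeFn_smul (inner ℂ ψ g : ℂ) (tens f ψ), coeFn_tens f ψ] with z h1 h2
  rw [h1, Pi.smul_apply, h2, L2.inner_def, projFun₂, smul_eq_mul, ← integral_mul_const]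
  refine integral_congr_ae (Filter.Eventually.of_forall fun s => ?_)
  simp only [RCLike.inner_apply]
  ring

theorem memLp_top_comp_snd {c : β → ℂ} (hc : MemLp c ∞ ν) :
    MemLp (fun z : α × β => c z.2) ∞ (μ.prod ν) := by
  refine ⟨hc.1.comp_snd, lt_of_le_of_lt ?_ hc.2⟩
  rw [eLpNorm_exponent_top, eLpNorm_exponent_top]
  exact essSup_le_of_ae_le _ (Measure.quasiMeasurePreserving_snd.ae ae_le_eLpNormEssSup)

theorem memLp_top_comp_fst {c : α → ℂ} (hc : MemLp c ∞ μ) :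
    MemLp (fun z : α × β => c z.1) ∞ (μ.prod ν) := by
  refine ⟨hc.1.comp_fst, lt_of_le_of_lt ?_ hc.2⟩
  rw [eLpNorm_exponent_top, eLpNorm_exponent_top]
  exact essSup_le_of_ae_le _ (Measure.quasiMeasurePreserving_fst.ae ae_le_eLpNormEssSup)

theorem mulOp_snd_tens {c : β → ℂ} (hc : MemLp c ∞ ν) (f : Lp ℂ 2 μ) (g : Lp ℂ 2 ν) :
    mulOp (μ.prod ν) (fun z => c z.2) (tens f g) = tens f (mulOp ν c g) := by
  refine Lp.ext ?_
  filter_upwards [coeFn_mulOp (memLp_top_comp_snd (μ := μ) hc) (tens f g), coeFn_tens f g,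
    coeFn_tens f (mulOp ν c g), ae_snd (μ := μ) (coeFn_mulOp hc g)] with z h1 h2 h3 h4
  rw [h1, h2, h3, h4]
  ring

theorem mulOp_fst_tens {c : α → ℂ} (hc : MemLp c ∞ μ) (f : Lp ℂ 2 μ) (g : Lp ℂ 2 ν) :
    mulOp (μ.prod ν) (fun z => c z.1) (tens f g) = tens (mulOp μ c f) g := by
  refine Lp.ext ?_
  filter_upwards [coeFn_mulOp (memLp_top_comp_fst (ν := ν) hc) (tens f g), coeFn_tens f g,
    coeFn_tens (mulOp μ c f) g, ae_fst (ν := ν) (coeFn_mulOp hc f)] with z h1 h2 h3 h4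
  rw [h1, h2, h3, h4]
  ring

theorem memLp_ofReal {γ : Type*} [MeasurableSpace γ] {ρ : Measure γ} (h : Lp ℝ ∞ ρ) :
    MemLp (fun y => ((h y : ℝ) : ℂ)) ∞ ρ :=
  (Lp.memLp h).ofReal

theorem T₁_tens {n : ℕ} (φ : Fin n → Lp ℂ 2 μ) (h : Fin n → Lp ℝ ∞ ν) (f : Lp ℂ 2 μ)
    (g : Lp ℂ 2 ν) :
    T₁ φ h (tens f g) =
      ∑ k, (inner ℂ (φ k) f : ℂ) • tens (φ k) (mulOp ν (fun y => ((h k y : ℝ) : ℂ)) g) := by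
  rw [T₁, ContinuousLinearMap.copy_eq, _root_.sum_apply]
  refine Finset.sum_congr rfl fun k _ => ?_
  rw [ContinuousLinearMap.comp_apply, P_tens, map_smul, mulOp_snd_tens (memLp_ofReal (h k))]

theorem T₂_tens {m : ℕ} (ψ : Fin m → Lp ℂ 2 ν) (p : Fin m → Lp ℝ ∞ μ) (g : Lp ℂ 2 ν)
    (f : Lp ℂ 2 μ) :
    T₂ ψ p (tens f g) =
      ∑ k, (inner ℂ (ψ k) g : ℂ) • tens (mulOp μ (fun x => ((p k x : ℝ) : ℂ)) f) (ψ k) := by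
  rw [T₂, ContinuousLinearMap.copy_eq, _root_.sum_apply]
  refine Finset.sum_congr rfl fun k _ => ?_
  rw [ContinuousLinearMap.comp_apply, Q_tens, map_smul, mulOp_fst_tens (memLp_ofReal (p k))]

theorem S₁_tens {n : ℕ} (φ : Fin n → Lp ℂ 2 μ) (h : Fin n → Lp ℝ ∞ ν) (τ : ℂ)
    (hτ : ∀ k, MemLp (fun y => ((h k y : ℝ) : ℂ) / (1 - τ * ((h k y : ℝ) : ℂ))) ∞ ν)
    (f : Lp ℂ 2 μ) (g : Lp ℂ 2 ν) :
    S₁ φ h τ (tens f g) = ∑ k, (inner ℂ (φ k) f : ℂ) •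
      tens (φ k) (mulOp ν (fun y => ((h k y : ℝ) : ℂ) / (1 - τ * ((h k y : ℝ) : ℂ))) g) := by
  rw [S₁, _root_.sum_apply]
  refine Finset.sum_congr rfl fun k _ => ?_
  rw [ContinuousLinearMap.comp_apply, P_tens, map_smul, mulOp_snd_tens (hτ k)]

/-- The analogue of `S₁` for the second variable:
`(S₂(τ) f)(x, y) = ∑ⱼ pⱼ(x) / (1 - τ pⱼ(x)) * (Qⱼ f)(x, y)`. -/
def S₂ {m : ℕ} (ψ : Fin m → Lp ℂ 2 ν) (p : Fin m → Lp ℝ ∞ μ) (τ : ℂ) :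
    Lp ℂ 2 (μ.prod ν) →L[ℂ] Lp ℂ 2 (μ.prod ν) :=
  ∑ k, mulOp (μ.prod ν) (fun z => ((p k z.1 : ℝ) : ℂ) / (1 - τ * ((p k z.1 : ℝ) : ℂ)))
    ∘L Q (ψ k)

theorem S₂_tens {m : ℕ} (ψ : Fin m → Lp ℂ 2 ν) (p : Fin m → Lp ℝ ∞ μ) (τ : ℂ)
    (hτ : ∀ k, MemLp (fun x => ((p k x : ℝ) : ℂ) / (1 - τ * ((p k x : ℝ) : ℂ))) ∞ μ)
    (g : Lp ℂ 2 ν) (f : Lp ℂ 2 μ) :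
    S₂ ψ p τ (tens f g) = ∑ k, (inner ℂ (ψ k) g : ℂ) •
      tens (mulOp μ (fun x => ((p k x : ℝ) : ℂ) / (1 - τ * ((p k x : ℝ) : ℂ))) f) (ψ k) := by
  rw [S₂, _root_.sum_apply]
  refine Finset.sum_congr rfl fun k _ => ?_
  rw [ContinuousLinearMap.comp_apply, Q_tens, map_smul, mulOp_fst_tens (hτ k)]

end Tensor

/-! ### The Fredholm alternative for finite-rank operators -/

section FiniteRank

variable {H : Type*} [NormedAddCommGroup H] [NormedSpace ℂ H]

/-- A fixed vector of `A` lies in the range of `A`, so restricting `1 - A` to that range does not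
change its kernel. -/
theorem fredholmDet_eq_zero_iff (A : H →L[ℂ] H)
    [FiniteDimensional ℂ (LinearMap.range (A : H →ₗ[ℂ] H))] :
    fredholmDet A = 0 ↔ ∃ v, v ≠ 0 ∧ A v = v := by
  rw [fredholmDet, ← not_iff_not, ← ne_eq, ← isUnit_iff_ne_zero, ← LinearMap.isUnit_iff_isUnit_det,
    LinearMap.isUnit_iff_ker_eq_bot, LinearMap.ker_eq_bot']
  constructor
  · rintro h ⟨v, hv, hAv⟩
    refine hv ?_
    have := h ⟨v, v, hAv⟩ (by
      refine Subtype.ext ?_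
      simp [hAv])
    simpa using congrArg Subtype.val this
  · rintro h ⟨v, hv⟩ hAv
    by_contra hne
    refine h ⟨v, fun h0 => hne (Subtype.ext h0), ?_⟩
    have hv' : v - A v = 0 := by simpa using congrArg Subtype.val hAv
    exact (sub_eq_zero.1 hv').symm

/-- On the finite-dimensional range of `K`, injectivity of `1 - K` gives surjectivity. Solving `u -
K u = K w` there yields `(1 - K) (w + u) = w`. -/
theorem isUnit_one_sub_of_finiteRank [CompleteSpace H] (K : H →L[ℂ] H)
    [FiniteDimensional ℂ (LinearMap.range (K : H →ₗ[ℂ] H))] (hK : ∀ v, K v = v → v = 0) :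
    IsUnit (1 - K) := by
  rw [ContinuousLinearMap.isUnit_iff_bijective]
  have hinj : Function.Injective (1 - K : H →L[ℂ] H) := by
    rw [injective_iff_map_eq_zero]
    intro v hv
    have hv' : v - K v = 0 := by simpa using hv
    exact hK v (sub_eq_zero.1 hv').symm
  refine ⟨hinj, fun w => ?_⟩
  let R := LinearMap.range (K : H →ₗ[ℂ] H)
  let k : R →ₗ[ℂ] R := LinearMap.id - (K : H →ₗ[ℂ] H).rangeRestrict ∘ₗ R.subtype
  have hk : Function.Injective k := by
    rw [injective_iff_map_eq_zero]
    intro v hv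
    have hv' : (v : H) - K v = 0 := by simpa [k, R] using congrArg Subtype.val hv
    exact Subtype.ext (hK v (sub_eq_zero.1 hv').symm)
  obtain ⟨u, hu⟩ := LinearMap.surjective_of_injective hk ⟨K w, w, rfl⟩
  refine ⟨w + u, ?_⟩
  have hu' : (u : H) - K u = K w := by
    have := congrArg Subtype.val hu
    simpa [k, R] using this
  simp only [sub_apply, one_apply_eq_self, map_add]
  rw [← hu']
  abel

end FiniteRank

/-! ### Isolated spectral points of self-adjoint operators -/

section Spectrum

variable {H : Type*} [NormedAddCommGroup H] [InnerProductSpace ℂ H] [CompleteSpace H]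

/-- As `z` is isolated, the indicator `f` of `{z}` and the function `g` equal to `(w - z)⁻¹` off `z`
are continuous on the spectrum. In the functional calculus `f(T)` maps into the eigenspace and `g(T)
(T - z) = 1 - f(T)`. So `g(T)` inverts `T - z` on the orthogonal complement of the eigenspace. -/
theorem exists_bound_of_isolated {T : H →L[ℂ] H} (hT : IsSelfAdjoint T) {z : ℂ} {ε : ℝ}
    (hε : 0 < ε) (hz : spectrum ℂ T ∩ Metric.ball z ε = {z}) :
    ∃ C > 0, ∀ v ∈ (Module.End.eigenspace (T : H →ₗ[ℂ] H) z)ᗮ, ‖v‖ ≤ C * ‖T v - z • v‖ := by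
  classical
  have hN : IsStarNormal T := hT.isStarNormal
  let f : ℂ → ℂ := fun w => if w = z then 1 else 0
  let g : ℂ → ℂ := fun w => if w = z then 0 else (w - z)⁻¹
  have hloc : ∀ w ∈ spectrum ℂ T, ∀ F : ℂ → ℂ, ContinuousOn F {z}ᶜ →
      ContinuousWithinAt F (spectrum ℂ T) w := by
    intro w hw F hF
    by_cases h : w = z
    · subst h
      have : {w} ∈ nhdsWithin w (spectrum ℂ T) := by
        rw [← hz]
        exact Filter.inter_mem self_mem_nhdsWithin
          (mem_nhdsWithin_of_mem_nhds (Metric.ball_mem_nhds w hε))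
      exact (continuousWithinAt_singleton (f := F)).mono_of_mem_nhdsWithin this
    · exact (hF.continuousAt (isOpen_compl_singleton.mem_nhds h)).continuousWithinAt
  have hf : ContinuousOn f (spectrum ℂ T) := fun w hw => hloc w hw f <|
    (continuousOn_const (c := (0 : ℂ))).congr fun w hw => if_neg hw
  have hg : ContinuousOn g (spectrum ℂ T) := fun w hw => hloc w hw g <| by
    refine ContinuousOn.congr (f := fun w => (w - z)⁻¹) ?_ fun w hw => if_neg hw
    exact (continuousOn_id.sub continuousOn_const).inv₀ fun w hw => sub_ne_zero.2 hw
  have hsub : cfc (fun w : ℂ => w - z) T = T - algebraMap ℂ (H →L[ℂ] H) z := by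
    rw [cfc_sub .., cfc_id' .., cfc_const ..]
  have h1 : (T - algebraMap ℂ (H →L[ℂ] H) z) * cfc f T = 0 := by
    rw [← hsub, ← cfc_mul ..]
    refine (cfc_congr fun w _ => ?_).trans (cfc_zero ℂ T)
    by_cases h : w = z <;> simp [f, h]
  have h2 : cfc f T + cfc g T * (T - algebraMap ℂ (H →L[ℂ] H) z) = 1 := by
    rw [← hsub, ← cfc_mul .., ← cfc_add ..]
    refine (cfc_congr fun w _ => ?_).trans (cfc_one ℂ T)
    by_cases h : w = z
    · simp [f, g, h]
    · simp [f, g, h, sub_ne_zero.2 h]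
  have h3 : IsSelfAdjoint (cfc f T) := by
    rw [IsSelfAdjoint, ← cfc_star]
    refine cfc_congr fun w _ => ?_
    by_cases h : w = z <;> simp [f, h]
  refine ⟨‖cfc g T‖ + 1, by positivity, fun v hv => ?_⟩
  have hev : ∀ u, cfc f T u ∈ Module.End.eigenspace (T : H →ₗ[ℂ] H) z := fun u => by
    rw [Module.End.mem_eigenspace_iff]
    have := congrArg (fun A : H →L[ℂ] H => A u) h1
    simpa [sub_eq_zero, Algebra.algebraMap_eq_smul_one] using this
  -- `f(T)` is self-adjoint with range in the eigenspace, so it kills the orthogonal complement.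
  have h0 : cfc f T v = 0 := by
    refine (inner_self_eq_zero (𝕜 := ℂ)).1 ?_
    have := h3.isSymmetric (cfc f T v) v
    simp only [ContinuousLinearMap.coe_coe] at this
    rw [← this]
    exact hv _ (hev _)
  have h4 : v = cfc g T (T v - z • v) := by
    have := congrArg (fun A : H →L[ℂ] H => A v) h2
    simpa [h0, Algebra.algebraMap_eq_smul_one, eq_comm] using this
  calc ‖v‖ = ‖cfc g T (T v - z • v)‖ := by rw [← h4]
    _ ≤ ‖cfc g T‖ * ‖T v - z • v‖ := (cfc g T).le_opNorm _
    _ ≤ _ := by gcongr; linarith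

/-- The eigenspace `N` is the fixed space of `K`, hence finite-dimensional. With `E` the orthogonal
projection onto `N`, the operator `T - z + E` is again invertible times (identity minus finite rank)
and is injective, so it is invertible. Then `T - w + E` is invertible for `w` near `z`, and as `E`
commutes with `T` and only `N` is affected by it, `T - w` is invertible for such `w ≠ z`. -/
theorem mem_discreteSpectrum_of_isUnit_mul {T : H →L[ℂ] H} (hT : IsSelfAdjoint T) {z : ℂ}
    {A K : H →L[ℂ] H} (hA : IsUnit A)
    (hK : FiniteDimensional ℂ (LinearMap.range (K : H →ₗ[ℂ] H)))
    (hTA : T - algebraMap ℂ (H →L[ℂ] H) z = A * (1 - K)) (hv : ∃ v, v ≠ 0 ∧ K v = v) :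
    z ∈ discreteSpectrum T := by
  obtain ⟨A, rfl⟩ := hA
  have happ : ∀ v, T v - z • v = (A : H →L[ℂ] H) (v - K v) := fun v => by
    have := congrArg (fun A : H →L[ℂ] H => A v) hTA
    simpa [Algebra.algebraMap_eq_smul_one] using this
  have hker : ∀ v, T v = z • v ↔ K v = v := fun v => by
    rw [← sub_eq_zero, happ, ← sub_eq_zero (a := K v), ← neg_sub v, neg_eq_zero]
    refine ⟨fun h => ?_, fun h => by rw [h, map_zero]⟩
    have := congrArg (A⁻¹ : (H →L[ℂ] H)ˣ).val h
    rwa [map_zero, ← mul_apply_eq_comp, Units.inv_mul] at this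
  have hmem : ∀ v, v ∈ Module.End.eigenspace (T : H →ₗ[ℂ] H) z ↔ K v = v := fun v => by
    rw [Module.End.mem_eigenspace_iff]
    exact hker v
  set N := Module.End.eigenspace (T : H →ₗ[ℂ] H) z with hN
  have hfin : FiniteDimensional ℂ N :=
    Submodule.finiteDimensional_of_le (S₂ := LinearMap.range (K : H →ₗ[ℂ] H))
      fun v hv => ⟨v, (hmem v).1 hv⟩
  have heig : Module.End.HasEigenvalue (T : H →ₗ[ℂ] H) z := by
    obtain ⟨v, hv0, hv⟩ := hv
    exact Module.End.hasEigenvalue_of_hasEigenvector ⟨(hmem v).2 hv, hv0⟩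
  have hreal : conj z = z := hT.isSymmetric.conj_eigenvalue_eq_self heig
  let E : H →L[ℂ] H := N.starProjection
  have hE : ∀ v, E v ∈ N := fun v => N.starProjection_apply_mem v
  have hEN : ∀ v ∈ N, E v = v := fun v hv => Submodule.starProjection_eq_self_iff.2 hv
  have hTE : T * E = z • E := by
    ext v
    exact Module.End.mem_eigenspace_iff.1 (hE v)
  have hEsa : star E = E := (isSelfAdjoint_starProjection N).star_eq
  -- Adjoint of `hTE`; this needs the eigenvalue to be real.
  have hET : E * T = z • E := by
    have := congrArg star hTE
    rwa [star_mul, hT.star_eq, hEsa, star_smul, hEsa, RCLike.star_def, hreal] at this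
  have hEE : E * E = E := by
    ext v
    exact hEN _ (hE v)
  have hR : IsUnit (T - algebraMap ℂ (H →L[ℂ] H) z + E) := by
    have e1 : T - algebraMap ℂ (H →L[ℂ] H) z + E = A * (1 - (K - (A⁻¹ : (H →L[ℂ] H)ˣ) * E)) := by
      rw [hTA, sub_sub_eq_add_sub, add_sub_right_comm, mul_add, Units.mul_inv_cancel_left]
    rw [e1]
    have hfr : FiniteDimensional ℂ
        (LinearMap.range ((K - (A⁻¹ : (H →L[ℂ] H)ˣ) * E : H →L[ℂ] H) : H →ₗ[ℂ] H)) := by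
      have hle : LinearMap.range ((K - (A⁻¹ : (H →L[ℂ] H)ˣ) * E : H →L[ℂ] H) : H →ₗ[ℂ] H) ≤
          LinearMap.range (K : H →ₗ[ℂ] H) ⊔
            N.map (((A⁻¹ : (H →L[ℂ] H)ˣ) : H →L[ℂ] H) : H →ₗ[ℂ] H) := by
        rintro _ ⟨v, rfl⟩
        refine Submodule.sub_mem _ (Submodule.mem_sup_left ⟨v, rfl⟩)
          (Submodule.mem_sup_right ⟨E v, hE v, rfl⟩)
      exact Submodule.finiteDimensional_of_le hle
    refine A.isUnit.mul (isUnit_one_sub_of_finiteRank _ fun v hv => ?_)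
    have h0 : T v - z • v + E v = 0 := by
      have := congrArg (fun B : H →L[ℂ] H => B v) e1
      have h' : ((1 - (K - (A⁻¹ : (H →L[ℂ] H)ˣ) * E) : H →L[ℂ] H)) v = 0 := by
        rw [sub_apply, hv, one_apply_eq_self, sub_self]
      rw [mul_apply_eq_comp, h', map_zero] at this
      simpa [Algebra.algebraMap_eq_smul_one] using this
    -- Applying `E` to `T v - z v + E v = 0` leaves `E v = 0`; then `v` is an eigenvector, so `v = E
    -- v = 0`.
    have h1 : E v = 0 := by
      have a1 := congrArg E h0
      have a2 := congrArg (fun B : H →L[ℂ] H => B v) hET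
      have a3 := congrArg (fun B : H →L[ℂ] H => B v) hEE
      simp only [mul_apply_eq_comp, smul_apply] at a2 a3
      rwa [map_add, map_sub, a2, a3, map_smul, sub_self, zero_add, map_zero] at a1
    rw [h1, add_zero, sub_eq_zero, hker] at h0
    rw [← h1]
    exact (hEN v ((hmem v).2 h0)).symm
  refine ⟨?_, heig, hfin⟩
  have hopen : ∀ᶠ w in nhds z, IsUnit (T - algebraMap ℂ (H →L[ℂ] H) w + E) := by
    have hc : ContinuousAt (fun w : ℂ => T - algebraMap ℂ (H →L[ℂ] H) w + E) z := by
      have : Continuous (algebraMap ℂ (H →L[ℂ] H)) := continuous_algebraMap ℂ (H →L[ℂ] H)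
      fun_prop
    exact hc.eventually (Units.isOpen.mem_nhds hR)
  obtain ⟨ε, hε, hball⟩ := Metric.eventually_nhds_iff_ball.1 hopen
  refine ⟨ε, hε, Set.eq_singleton_iff_unique_mem.2
    ⟨⟨?_, Metric.mem_ball_self hε⟩, fun w hw => ?_⟩⟩
  · intro hunit
    obtain ⟨v, hv0, hv⟩ := hv
    have hu : IsUnit (algebraMap ℂ (H →L[ℂ] H) z - T) := hunit
    have hinj := (ContinuousLinearMap.isUnit_iff_bijective.1 hu).1
    refine hv0 (hinj ?_)
    rw [map_zero]
    simp [Algebra.algebraMap_eq_smul_one, (hker v).2 hv]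
  · by_contra hne
    refine hw.1 ?_
    obtain ⟨U, hU⟩ := hball w hw.2
    have hzw : z - w ≠ 0 := sub_ne_zero.2 fun h => hne h.symm
    have hTw : T - algebraMap ℂ (H →L[ℂ] H) w = U - E := by rw [hU]; abel
    have hTwE : (T - algebraMap ℂ (H →L[ℂ] H) w) * E = (z - w) • E := by
      rw [sub_mul, hTE, Algebra.algebraMap_eq_smul_one, smul_mul_assoc, one_mul, sub_smul]
    have hETw : E * (T - algebraMap ℂ (H →L[ℂ] H) w) = (z - w) • E := by
      rw [mul_sub, hET, Algebra.algebraMap_eq_smul_one, mul_smul_comm, mul_one, sub_smul]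
    have hcU : Commute E U := by
      have : (U : H →L[ℂ] H) = T - algebraMap ℂ (H →L[ℂ] H) w + E := hU
      rw [this]
      exact Commute.add_right (hETw.trans hTwE.symm) (Commute.refl E)
    have hcU' : Commute E (U⁻¹ : (H →L[ℂ] H)ˣ) := hcU.units_inv_right
    -- On `N` the operator `T - w` is the scalar `z - w`; on the complement it agrees with `U`. `V`
    -- inverts the two pieces separately.
    let V : H →L[ℂ] H := (U⁻¹ : (H →L[ℂ] H)ˣ) * (1 - E) + (z - w)⁻¹ • E
    have hE1 : E * (1 - E) = 0 := by rw [mul_sub, mul_one, hEE, sub_self]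
    have hE2 : (1 - E) * E = 0 := by rw [sub_mul, one_mul, hEE, sub_self]
    have hV1 : (T - algebraMap ℂ (H →L[ℂ] H) w) * V = 1 := by
      have e : E * ((U⁻¹ : (H →L[ℂ] H)ˣ) * (1 - E)) = 0 := by
        rw [← mul_assoc, hcU'.eq, mul_assoc, hE1, mul_zero]
      rw [mul_add, mul_smul_comm, hTwE, smul_smul, inv_mul_cancel₀ hzw, one_smul, hTw, sub_mul, e,
        Units.mul_inv_cancel_left]
      abel
    have hcTU : Commute (T - algebraMap ℂ (H →L[ℂ] H) w) (U⁻¹ : (H →L[ℂ] H)ˣ) := by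
      refine Commute.units_inv_right ?_
      rw [hTw]
      exact (Commute.refl _).sub_left hcU
    have hcTE : Commute (T - algebraMap ℂ (H →L[ℂ] H) w) E := hTwE.trans hETw.symm
    have hcTV : Commute (T - algebraMap ℂ (H →L[ℂ] H) w) V :=
      (hcTU.mul_right ((Commute.one_right _).sub_right hcTE)).add_right (hcTE.smul_right _)
    have hunit : IsUnit (T - algebraMap ℂ (H →L[ℂ] H) w) :=
      ⟨⟨_, V, hV1, hcTV.eq ▸ hV1⟩, rfl⟩
    have := hunit.neg
    rwa [neg_sub] at this

end Spectrum

/-! ### Multiplication operators: approximate eigenvectors and resolvents -/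

section ApproximateEigenvectors

/-- `A` has approximate eigenvectors for `l` in the kernel of every linear map to a
finite-dimensional space. -/
def ApproxEigen {H : Type*} [NormedAddCommGroup H] [NormedSpace ℂ H] (A : H →L[ℂ] H) (l : ℂ) :
    Prop :=
  ∀ ε > 0, ∀ (V : Type) [AddCommGroup V] [Module ℂ V] [FiniteDimensional ℂ V] (L : H →ₗ[ℂ] V),
    ∃ g, g ≠ 0 ∧ L g = 0 ∧ ‖A g - l • g‖ ≤ ε * ‖g‖

theorem exists_ne_zero_of_not_finiteDimensional {X V : Type*} [AddCommGroup X] [Module ℂ X]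
    [AddCommGroup V] [Module ℂ V] [FiniteDimensional ℂ V] (hX : ¬ FiniteDimensional ℂ X)
    (L : X →ₗ[ℂ] V) : ∃ x, x ≠ 0 ∧ L x = 0 := by
  by_contra! hL
  refine hX (FiniteDimensional.of_injective L ((injective_iff_map_eq_zero L).2 fun x hx => ?_))
  by_contra hne
  exact hL x hne hx

/-- `l` has positive distance from the essential range of `h`. -/
def Separated {γ : Type*} [MeasurableSpace γ] (ρ : Measure γ) (l : ℂ) (h : γ → ℝ) : Prop :=
  ∃ δ > 0, ∀ᵐ y ∂ρ, δ ≤ ‖l - ((h y : ℝ) : ℂ)‖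

section Polynomial

variable {a b : ℝ} {s : Set ℝ}

theorem memLp_indicator_eval (hs : MeasurableSet s) (q : Polynomial ℂ) :
    MemLp (s.indicator fun y : ℝ => q.eval (y : ℂ)) 2 (volume.restrict (Icc a b)) := by
  have hc : Continuous fun y : ℝ => q.eval (y : ℂ) := q.continuous.comp Complex.continuous_ofReal
  obtain ⟨C, hC⟩ := isCompact_Icc.exists_bound_of_continuousOn (hc.continuousOn (s := Icc a b))
  refine (MemLp.of_bound hc.aestronglyMeasurable C ?_).indicator hs
  exact (ae_restrict_iff' measurableSet_Icc).2 (Filter.Eventually.of_forall hC)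

/-- The square integrable function `1_s * q` on `[a, b]`, for a polynomial `q`. -/
def polyIndicator (a b : ℝ) (hs : MeasurableSet s) :
    Polynomial ℂ →ₗ[ℂ] Lp ℂ 2 (volume.restrict (Icc a b)) where
  toFun q := (memLp_indicator_eval hs q).toLp _
  map_add' q r := by
    rw [← MemLp.toLp_add, MemLp.toLp_eq_toLp_iff]
    refine Filter.Eventually.of_forall fun y => ?_
    by_cases hy : y ∈ s <;> simp [hy]
  map_smul' c q := by
    rw [RingHom.id_apply, ← MemLp.toLp_const_smul, MemLp.toLp_eq_toLp_iff]
    refine Filter.Eventually.of_forall fun y => ?_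
    by_cases hy : y ∈ s <;> simp [hy]

theorem coeFn_polyIndicator (hs : MeasurableSet s) (q : Polynomial ℂ) :
    polyIndicator a b hs q =ᵐ[volume.restrict (Icc a b)]
      s.indicator fun y : ℝ => q.eval (y : ℂ) :=
  MemLp.coeFn_toLp (memLp_indicator_eval hs q)

/-- A nonzero polynomial has finitely many roots, a null set. So polynomials embed into the
functions supported on any set of positive measure, which supplies the infinite-dimensional spaces
needed below. -/
theorem polyIndicator_ne_zero (hs : MeasurableSet s)
    (hpos : volume.restrict (Icc a b) s ≠ 0) {q : Polynomial ℂ} (hq : q ≠ 0) :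
    polyIndicator a b hs q ≠ 0 := by
  intro h0
  refine hpos ?_
  have h1 : s.indicator (fun y : ℝ => q.eval (y : ℂ)) =ᵐ[volume.restrict (Icc a b)] 0 :=
    (coeFn_polyIndicator hs q).symm.trans (h0 ▸ Lp.coeFn_zero ..)
  have hfin : {y : ℝ | q.eval (y : ℂ) = 0}.Finite := by
    have : {z : ℂ | q.IsRoot z}.Finite := Polynomial.finite_setOfPred_isRoot hq
    exact this.preimage Complex.ofReal_injective.injOn
  have h2 : ∀ᵐ y ∂(volume.restrict (Icc a b)), y ∉ {y : ℝ | q.eval (y : ℂ) = 0} :=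
    measure_eq_zero_iff_ae_notMem.1 (hfin.measure_zero _)
  rw [measure_eq_zero_iff_ae_notMem]
  filter_upwards [h1, h2] with y hy hy' hys
  rw [indicator_of_mem hys] at hy
  exact hy' hy

theorem not_finiteDimensional_Lp (hab : a < b) :
    ¬ FiniteDimensional ℂ (Lp ℂ 2 (volume.restrict (Icc a b))) := by
  intro hfin
  have hpos : volume.restrict (Icc a b) univ ≠ 0 := by simp [hab]
  refine Polynomial.not_finite (R := ℂ) (Module.Finite.of_injective
    (polyIndicator a b MeasurableSet.univ) ((injective_iff_map_eq_zero _).2 fun q hq => ?_))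
  by_contra hne
  exact polyIndicator_ne_zero .univ hpos hne hq

/-- Without separation, the set where `|l - h| < ε` has positive measure. Every function supported
there satisfies the estimate, and infinitely many dimensions of them leave a nonzero one in the
kernel of `L`. -/
theorem approxEigen_mulOp {l : ℂ} {h : Lp ℝ ∞ (volume.restrict (Icc a b))}
    (hl : ¬ Separated (volume.restrict (Icc a b)) l h) :
    ApproxEigen (mulOp (volume.restrict (Icc a b)) fun y => ((h y : ℝ) : ℂ)) l := by
  intro ε hε V _ _ _ L
  let s : Set ℝ := {y | ‖l - ((h y : ℝ) : ℂ)‖ < ε}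
  have hs : MeasurableSet s := by
    have hm : Measurable h := (Lp.stronglyMeasurable h).measurable
    exact measurableSet_lt (by fun_prop) measurable_const
  have hpos : volume.restrict (Icc a b) s ≠ 0 := by
    intro h0
    refine hl ⟨ε, hε, ?_⟩
    filter_upwards [measure_eq_zero_iff_ae_notMem.1 h0] with y hy
    exact not_lt.1 hy
  obtain ⟨q, hq, hLq⟩ := exists_ne_zero_of_not_finiteDimensional
    (Polynomial.not_finite (R := ℂ)) (L ∘ₗ polyIndicator a b hs)
  refine ⟨polyIndicator a b hs q, polyIndicator_ne_zero hs hpos hq, hLq, ?_⟩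
  refine Lp.norm_le_mul_norm_of_ae_le_mul ?_
  filter_upwards [coeFn_polyIndicator hs q,
    Lp.coeFn_sub (mulOp _ (fun y => ((h y : ℝ) : ℂ)) (polyIndicator a b hs q))
      (l • polyIndicator a b hs q), Lp.coeFn_smul l (polyIndicator a b hs q),
    coeFn_mulOp (memLp_ofReal h) (polyIndicator a b hs q)] with y h1 h2 h3 h4
  rw [h2, Pi.sub_apply, h3, h4, Pi.smul_apply, smul_eq_mul, ← sub_mul, norm_mul, h1]
  by_cases hy : y ∈ s
  · gcongr
    rw [norm_sub_rev]
    exact le_of_lt hy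
  · simp [hy]

end Polynomial

section Multiplication

variable {γ : Type*} [MeasurableSpace γ] {ρ : Measure γ}

theorem isSymmetric_mulOp (h : Lp ℝ ∞ ρ) :
    (mulOp ρ fun y => ((h y : ℝ) : ℂ) : Lp ℂ 2 ρ →ₗ[ℂ] Lp ℂ 2 ρ).IsSymmetric := by
  intro f g
  rw [L2.inner_def, L2.inner_def]
  refine integral_congr_ae ?_
  filter_upwards [coeFn_mulOp (memLp_ofReal h) f, coeFn_mulOp (memLp_ofReal h) g] with y h1 h2
  rw [ContinuousLinearMap.coe_coe, h1, h2]
  simp only [RCLike.inner_apply, map_mul, Complex.conj_ofReal]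
  ring

theorem memLp_div_of_separated {l : ℂ} (hl0 : l ≠ 0) {h : Lp ℝ ∞ ρ} (hl : Separated ρ l h) :
    MemLp (fun y => ((h y : ℝ) : ℂ) / (1 - l⁻¹ * ((h y : ℝ) : ℂ))) ∞ ρ := by
  obtain ⟨δ, hδ, hl⟩ := hl
  have hm : AEStronglyMeasurable (fun y => (1 - l⁻¹ * ((h y : ℝ) : ℂ))⁻¹) ρ :=
    ((aestronglyMeasurable_const.sub
      (aestronglyMeasurable_const.mul (memLp_ofReal h).1)).aemeasurable.inv).aestronglyMeasurable
  have hb : MemLp (fun y => (1 - l⁻¹ * ((h y : ℝ) : ℂ))⁻¹) ∞ ρ := by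
    refine memLp_top_of_bound hm (‖l‖ / δ) ?_
    filter_upwards [hl] with y hy
    have e : 1 - l⁻¹ * ((h y : ℝ) : ℂ) = l⁻¹ * (l - h y) := by
      rw [mul_sub, inv_mul_cancel₀ hl0]
    rw [e, mul_inv, inv_inv, norm_mul, norm_inv, ← div_eq_mul_inv]
    gcongr
  have := hb.mul' (r := ∞) (memLp_ofReal h)
  simpa only [div_eq_mul_inv] using this

/-- Both parts are the scalar identity `C - l⁻¹ h C = h` for `C = h / (1 - l⁻¹ h)`. The two orders
of composition are the left and right resolvent identities used by `unitOneSub`. -/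
theorem mulOp_resolvent {l : ℂ} (hl0 : l ≠ 0) {h : Lp ℝ ∞ ρ} (hl : Separated ρ l h)
    (g : Lp ℂ 2 ρ) :
    mulOp ρ (fun y => ((h y : ℝ) : ℂ) / (1 - l⁻¹ * ((h y : ℝ) : ℂ))) g -
      l⁻¹ • mulOp ρ (fun y => ((h y : ℝ) : ℂ))
        (mulOp ρ (fun y => ((h y : ℝ) : ℂ) / (1 - l⁻¹ * ((h y : ℝ) : ℂ))) g) =
      mulOp ρ (fun y => ((h y : ℝ) : ℂ)) g ∧
    mulOp ρ (fun y => ((h y : ℝ) : ℂ) / (1 - l⁻¹ * ((h y : ℝ) : ℂ))) g -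
      l⁻¹ • mulOp ρ (fun y => ((h y : ℝ) : ℂ) / (1 - l⁻¹ * ((h y : ℝ) : ℂ)))
        (mulOp ρ (fun y => ((h y : ℝ) : ℂ)) g) =
      mulOp ρ (fun y => ((h y : ℝ) : ℂ)) g := by
  have hC := memLp_div_of_separated hl0 hl
  obtain ⟨δ, hδ, hl⟩ := hl
  set C := fun y => ((h y : ℝ) : ℂ) / (1 - l⁻¹ * ((h y : ℝ) : ℂ)) with hCdef
  set A := fun y => ((h y : ℝ) : ℂ) with hAdef
  have hA : MemLp A ∞ ρ := memLp_ofReal h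
  have hCA : ∀ᵐ y ∂ρ, C y - l⁻¹ * A y * C y = A y := by
    filter_upwards [hl] with y hy
    have h0 : l - h y ≠ 0 := norm_pos_iff.1 (hδ.trans_le hy)
    have e : 1 - l⁻¹ * ((h y : ℝ) : ℂ) ≠ 0 := by
      rw [show 1 - l⁻¹ * ((h y : ℝ) : ℂ) = l⁻¹ * (l - h y) by rw [mul_sub, inv_mul_cancel₀ hl0]]
      exact mul_ne_zero (inv_ne_zero hl0) h0
    rw [show C y - l⁻¹ * A y * C y = (1 - l⁻¹ * A y) * C y by ring]
    simp only [hCdef, hAdef]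
    exact mul_div_cancel₀ _ e
  constructor
  · refine Lp.ext ?_
    filter_upwards [hCA, coeFn_mulOp hC g, coeFn_mulOp hA g, coeFn_mulOp hA (mulOp ρ C g),
      Lp.coeFn_sub (mulOp ρ C g) (l⁻¹ • mulOp ρ A (mulOp ρ C g)),
      Lp.coeFn_smul l⁻¹ (mulOp ρ A (mulOp ρ C g))] with y h1 h2 h3 h4 h5 h6
    rw [h5, Pi.sub_apply, h6, Pi.smul_apply, h4, h2, h3, smul_eq_mul]
    linear_combination g y * h1
  · refine Lp.ext ?_
    filter_upwards [hCA, coeFn_mulOp hC g, coeFn_mulOp hA g, coeFn_mulOp hC (mulOp ρ A g),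
      Lp.coeFn_sub (mulOp ρ C g) (l⁻¹ • mulOp ρ C (mulOp ρ A g)),
      Lp.coeFn_smul l⁻¹ (mulOp ρ C (mulOp ρ A g))] with y h1 h2 h3 h4 h5 h6
    rw [h5, Pi.sub_apply, h6, Pi.smul_apply, h4, h2, h3, smul_eq_mul]
    linear_combination g y * h1

end Multiplication

end ApproximateEigenvectors

/-! ### Partial operators on an abstract Hilbert tensor product -/

section AbstractTensor

variable {H₁ H₂ : Type*} {H : Type}
  [NormedAddCommGroup H₁] [InnerProductSpace ℂ H₁]
  [NormedAddCommGroup H₂] [InnerProductSpace ℂ H₂]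
  [NormedAddCommGroup H] [InnerProductSpace ℂ H] [CompleteSpace H]

/-- The bilinear map `t` exhibits `H` as a Hilbert tensor product of `H₁` and `H₂`. -/
structure IsTensor (t : H₁ →ₗ[ℂ] H₂ →ₗ[ℂ] H) : Prop where
  inner_map : ∀ f f' g g', (inner ℂ (t f g) (t f' g') : ℂ) = inner ℂ f f' * inner ℂ g g'
  total : ∀ u, (∀ f g, (inner ℂ (t f g) u : ℂ) = 0) → u = 0

/-- `T = ∑ₖ |φₖ⟩⟨φₖ| ⊗ Aₖ`. -/
def IsPartial {n : ℕ} (t : H₁ →ₗ[ℂ] H₂ →ₗ[ℂ] H) (φ : Fin n → H₁) (A : Fin n → H₂ →L[ℂ] H₂)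
    (T : H →L[ℂ] H) : Prop :=
  ∀ f g, T (t f g) = ∑ k, (inner ℂ (φ k) f : ℂ) • t (φ k) (A k g)

variable {t : H₁ →ₗ[ℂ] H₂ →ₗ[ℂ] H} {n m : ℕ}

/-- Exchanging the factors lets `T₂` be treated by the results for `T₁`. -/
theorem IsTensor.flip (ht : IsTensor t) : IsTensor t.flip where
  inner_map f f' g g' := by
    simp only [LinearMap.flip_apply]
    rw [ht.inner_map, mul_comm]
  total u hu := ht.total u fun f g => hu g f

theorem IsTensor.ext (ht : IsTensor t) {A B : H →L[ℂ] H} (hAB : ∀ f g, A (t f g) = B (t f g)) :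
    A = B := by
  have h : ContinuousLinearMap.adjoint (A - B) = 0 := by
    ext w
    refine ht.total _ fun f g => ?_
    rw [ContinuousLinearMap.adjoint_inner_right, sub_apply, hAB, sub_self, inner_zero_left]
  rw [← sub_eq_zero, ← ContinuousLinearMap.adjoint_adjoint (A - B), h, map_zero]

theorem IsTensor.norm_map (ht : IsTensor t) (f : H₁) (g : H₂) : ‖t f g‖ = ‖f‖ * ‖g‖ := by
  have h := ht.inner_map f f g g
  rw [inner_self_eq_norm_sq_to_K, inner_self_eq_norm_sq_to_K, inner_self_eq_norm_sq_to_K,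
    ← mul_pow] at h
  have h' : ‖t f g‖ ^ 2 = (‖f‖ * ‖g‖) ^ 2 := by exact_mod_cast h
  exact (pow_left_inj₀ (norm_nonneg _) (by positivity) two_ne_zero).1 h'

theorem IsTensor.map_ne_zero (ht : IsTensor t) {f : H₁} {g : H₂} (hf : f ≠ 0) (hg : g ≠ 0) :
    t f g ≠ 0 := by
  rw [← norm_ne_zero_iff, ht.norm_map]
  exact mul_ne_zero (norm_ne_zero_iff.2 hf) (norm_ne_zero_iff.2 hg)

variable {φ : Fin n → H₁} {A C : Fin n → H₂ →L[ℂ] H₂} {T S : H →L[ℂ] H}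

theorem IsPartial.isSelfAdjoint (ht : IsTensor t) (hT : IsPartial t φ A T)
    (hA : ∀ k, (A k : H₂ →ₗ[ℂ] H₂).IsSymmetric) : IsSelfAdjoint T := by
  rw [ContinuousLinearMap.isSelfAdjoint_iff']
  refine ht.ext fun f g => ?_
  rw [← sub_eq_zero]
  refine ht.total _ fun f' g' => ?_
  rw [inner_sub_right, ContinuousLinearMap.adjoint_inner_right, hT, hT, sum_inner, inner_sum,
    sub_eq_zero]
  refine Finset.sum_congr rfl fun k _ => ?_
  have := hA k g' g
  simp only [ContinuousLinearMap.coe_coe] at this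
  rw [inner_smul_left, inner_smul_right, ht.inner_map, ht.inner_map, inner_conj_symm, this]
  ring

/-- Orthonormality of `φ` kills the cross terms, so operators of this form multiply coefficientwise
and their resolvent identities reduce to those of the coefficients. -/
theorem IsPartial.mul (hφ : Orthonormal ℂ φ) (hT : IsPartial t φ A T) (hS : IsPartial t φ C S) :
    IsPartial t φ (fun k => A k * C k) (T * S) := by
  classical
  intro f g
  rw [mul_apply_eq_comp, hS, map_sum]
  refine Finset.sum_congr rfl fun k _ => ?_
  rw [map_smul, hT, Finset.sum_eq_single k]
  · rw [inner_self_eq_norm_sq_to_K, hφ.1 k, mul_apply_eq_comp]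
    simp
  · intro j _ hj
    rw [hφ.2 hj, zero_smul]
  · simp

theorem IsPartial.sub_smul_mul (ht : IsTensor t) (hφ : Orthonormal ℂ φ) (hT : IsPartial t φ A T)
    (hS : IsPartial t φ C S) {τ : ℂ} (hAC : ∀ k g, C k g - τ • A k (C k g) = A k g) :
    S - τ • (T * S) = T := by
  refine ht.ext fun f g => ?_
  rw [sub_apply, smul_apply, hS, hT.mul hφ hS, hT, Finset.smul_sum, ← Finset.sum_sub_distrib]
  refine Finset.sum_congr rfl fun k _ => ?_
  rw [smul_comm, ← smul_sub, ← map_smul, ← map_sub, mul_apply_eq_comp, hAC]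

theorem IsPartial.sub_smul_mul' (ht : IsTensor t) (hφ : Orthonormal ℂ φ) (hT : IsPartial t φ A T)
    (hS : IsPartial t φ C S) {τ : ℂ} (hAC : ∀ k g, C k g - τ • C k (A k g) = A k g) :
    S - τ • (S * T) = T := by
  refine ht.ext fun f g => ?_
  rw [sub_apply, smul_apply, hS, hS.mul hφ hT, hT, Finset.smul_sum, ← Finset.sum_sub_distrib]
  refine Finset.sum_congr rfl fun k _ => ?_
  rw [smul_comm, ← smul_sub, ← map_smul, ← map_sub, mul_apply_eq_comp, hAC]

/-- The resolvent `(1 - τ T)⁻¹ = 1 + τ S`, when `S - τ T S = T = S - τ S T`. -/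
def unitOneSub {R : Type*} [Ring R] [Algebra ℂ R] {T S : R} {τ : ℂ}
    (h1 : S - τ • (T * S) = T) (h2 : S - τ • (S * T) = T) : Rˣ where
  val := 1 - τ • T
  inv := 1 + τ • S
  val_inv := by
    have : (1 - τ • T) * (1 + τ • S) = 1 + τ • (S - τ • (T * S)) - τ • T := by
      simp only [mul_add, sub_mul, mul_one, one_mul, smul_mul_assoc, mul_smul_comm, smul_sub]
      abel
    rw [this, h1, add_sub_cancel_right]
  inv_val := by
    have : (1 + τ • S) * (1 - τ • T) = 1 + τ • (S - τ • (S * T)) - τ • T := by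
      simp only [mul_sub, add_mul, mul_one, one_mul, smul_mul_assoc, mul_smul_comm, smul_sub,
        smul_add]
      abel
    rw [this, h2, add_sub_cancel_right]

theorem mem_resolventSet_of_isUnit {R : Type*} [Ring R] [Algebra ℂ R] {T : R} {l : ℂ}
    (hl : l ≠ 0) (hT : IsUnit (1 - l⁻¹ • T)) : l ∈ resolventSet ℂ T := by
  have h := hT.smul (Units.mk0 l hl)
  rw [spectrum.mem_resolventSet_iff, Algebra.algebraMap_eq_smul_one]
  rwa [Units.smul_def, Units.val_mk0, smul_sub, smul_smul, mul_inv_cancel₀ hl, one_smul] at h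

/-- A product `f ⊗ g` with `g` orthogonal to all `ψ j` is killed by `T₂`. For `l = 0` take also `f`
orthogonal to all `φ k`, so that `T` kills it too. Otherwise take `f = φ k`, on which `T` acts as `A
k` in the second factor. The conditions on `g`, including `L = 0`, are finitely many and linear. -/
theorem exists_approx_of_isPartial {ψ : Fin m → H₂} {D : Fin m → H₁ →L[ℂ] H₁} {T₂ : H →L[ℂ] H}
    (ht : IsTensor t) (hφ : Orthonormal ℂ φ) (hT : IsPartial t φ A T)
    (hT₂ : IsPartial t.flip ψ D T₂) (h₁ : ¬ FiniteDimensional ℂ H₁)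
    (h₂ : ¬ FiniteDimensional ℂ H₂) {l : ℂ} (hl : l = 0 ∨ ∃ k, ApproxEigen (A k) l)
    {ε : ℝ} (hε : 0 < ε) {V : Type} [AddCommGroup V] [Module ℂ V] [FiniteDimensional ℂ V]
    (L : H →ₗ[ℂ] V) :
    ∃ v, v ≠ 0 ∧ L v = 0 ∧ T₂ v = 0 ∧ ‖T v - l • v‖ ≤ ε * ‖v‖ := by
  have hT₂0 : ∀ f g, (∀ j, (inner ℂ (ψ j) g : ℂ) = 0) → T₂ (t f g) = 0 := by
    intro f g hg
    have := hT₂ g f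
    rw [LinearMap.flip_apply] at this
    rw [this]
    exact Finset.sum_eq_zero fun j _ => by rw [hg j, zero_smul]
  let Ψ : H₂ →ₗ[ℂ] (Fin m → ℂ) := LinearMap.pi fun j => (innerSL ℂ (ψ j) : H₂ →ₗ[ℂ] ℂ)
  have hΨ : ∀ g, Ψ g = 0 → ∀ j, (inner ℂ (ψ j) g : ℂ) = 0 := fun g hg j => congrFun hg j
  rcases hl with rfl | ⟨k, hk⟩
  · let Φ : H₁ →ₗ[ℂ] (Fin n → ℂ) := LinearMap.pi fun j => (innerSL ℂ (φ j) : H₁ →ₗ[ℂ] ℂ)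
    obtain ⟨f, hf0, hf⟩ := exists_ne_zero_of_not_finiteDimensional h₁ Φ
    obtain ⟨g, hg0, hg⟩ := exists_ne_zero_of_not_finiteDimensional h₂ (Ψ.prod (L ∘ₗ t f))
    have hf' : ∀ j, (inner ℂ (φ j) f : ℂ) = 0 := fun j => congrFun hf j
    have hg1 : Ψ g = 0 := congrArg Prod.fst hg
    refine ⟨t f g, ht.map_ne_zero hf0 hg0, congrArg Prod.snd hg, hT₂0 f g (hΨ g hg1), ?_⟩
    have : T (t f g) = 0 := by
      rw [hT]
      exact Finset.sum_eq_zero fun j _ => by rw [hf' j, zero_smul]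
    rw [this, zero_smul, sub_zero, norm_zero]
    positivity
  · obtain ⟨g, hg0, hg, hgε⟩ := hk ε hε _ (Ψ.prod (L ∘ₗ t (φ k)))
    have hg1 : Ψ g = 0 := congrArg Prod.fst hg
    have hφ1 : ‖φ k‖ = 1 := hφ.1 k
    have hφ0 : φ k ≠ 0 := by rw [← norm_ne_zero_iff, hφ1]; exact one_ne_zero
    refine ⟨t (φ k) g, ht.map_ne_zero hφ0 hg0, congrArg Prod.snd hg,
      hT₂0 _ g (hΨ g hg1), ?_⟩
    have : T (t (φ k) g) = t (φ k) (A k g) := by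
      rw [hT, Finset.sum_eq_single k]
      · rw [inner_self_eq_norm_sq_to_K, hφ1]
        simp
      · intro j _ hj
        rw [hφ.2 hj, zero_smul]
      · simp
    rw [this, ← map_smul, ← map_sub, ht.norm_map, ht.norm_map, hφ1, one_mul, one_mul]
    exact hgε

theorem not_mem_resolventSet_of_approx {l : ℂ}
    (h : ∀ ε > 0, ∃ v, v ≠ 0 ∧ ‖T v - l • v‖ ≤ ε * ‖v‖) : l ∉ resolventSet ℂ T := by
  intro hl
  obtain ⟨U, hU⟩ := spectrum.mem_resolventSet_iff.1 hl
  set R : H →L[ℂ] H := ((U⁻¹ : (H →L[ℂ] H)ˣ) : H →L[ℂ] H)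
  have hR : ∀ v, ‖v‖ ≤ ‖R‖ * ‖T v - l • v‖ := fun v => by
    have e : v = R (l • v - T v) := by
      have := congrArg (fun B : H →L[ℂ] H => B v) U.inv_mul
      rw [hU] at this
      simpa [Algebra.algebraMap_eq_smul_one, eq_comm] using this
    calc ‖v‖ = ‖R (l • v - T v)‖ := by rw [← e]
      _ ≤ ‖R‖ * ‖l • v - T v‖ := R.le_opNorm _
      _ = _ := by rw [norm_sub_rev]
  -- This `ε` forces `‖v‖ ≤ ‖v‖ / 2`; the `+ 1` keeps it positive and finite even if `R = 0`.
  obtain ⟨v, hv0, hv⟩ := h (2 * (‖R‖ + 1))⁻¹ (by positivity)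
  have hpos : 0 < ‖v‖ := norm_pos_iff.2 hv0
  have h1 : ‖v‖ ≤ (‖R‖ + 1) * ((2 * (‖R‖ + 1))⁻¹ * ‖v‖) :=
    (hR v).trans (by gcongr; linarith)
  have h2 : (‖R‖ + 1) * ((2 * (‖R‖ + 1))⁻¹ * ‖v‖) = ‖v‖ / 2 := by
    field_simp
  linarith

/-- Taking for `L` the projection onto the finite-dimensional eigenspace puts the approximate
eigenvectors in its complement, where `exists_bound_of_isolated` forbids them. As `L` takes values
in a subspace of `H`, the universe of `H` must be that of `V`. -/
theorem not_mem_discreteSpectrum_of_approx (hT : IsSelfAdjoint T) {l : ℂ}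
    (h : ∀ ε > 0, ∀ (V : Type) [AddCommGroup V] [Module ℂ V] [FiniteDimensional ℂ V]
      (L : H →ₗ[ℂ] V), ∃ v, v ≠ 0 ∧ L v = 0 ∧ ‖T v - l • v‖ ≤ ε * ‖v‖) :
    l ∉ discreteSpectrum T := by
  rintro ⟨⟨ε, hε, hs⟩, -, hfin⟩
  obtain ⟨C, hC, hb⟩ := exists_bound_of_isolated hT hε hs
  set N := Module.End.eigenspace (T : H →ₗ[ℂ] H) l
  obtain ⟨v, hv0, hvN, hv⟩ := h (2 * C)⁻¹ (by positivity) N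
    (N.orthogonalProjectionOnto : H →ₗ[ℂ] N)
  have hv' : v ∈ Nᗮ := Submodule.orthogonalProjectionOnto_eq_zero_iff.1 hvN
  have hpos : 0 < ‖v‖ := norm_pos_iff.2 hv0
  have h1 : ‖v‖ ≤ C * ((2 * C)⁻¹ * ‖v‖) := (hb v hv').trans (by gcongr)
  have h2 : C * ((2 * C)⁻¹ * ‖v‖) = ‖v‖ / 2 := by field_simp
  linarith

end AbstractTensor

/-! ### Fixed vectors of a finite-rank operator in coordinates -/

section FiniteRankMatrix

variable {ι H : Type*} [Fintype ι] [NormedAddCommGroup H] [InnerProductSpace ℂ H]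

theorem finiteDimensional_range_of_sum {K : H →L[ℂ] H} {b r : ι → H}
    (hK : ∀ v, K v = ∑ ω, (inner ℂ (b ω) v : ℂ) • r ω) :
    FiniteDimensional ℂ (LinearMap.range (K : H →ₗ[ℂ] H)) := by
  have : FiniteDimensional ℂ (Submodule.span ℂ (range r)) :=
    FiniteDimensional.span_of_finite ℂ (finite_range r)
  refine Submodule.finiteDimensional_of_le (S₂ := Submodule.span ℂ (range r)) ?_
  rintro _ ⟨v, rfl⟩
  rw [ContinuousLinearMap.coe_coe, hK]
  exact Submodule.sum_mem _ fun ω _ => Submodule.smul_mem _ _ (Submodule.subset_span ⟨ω, rfl⟩)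

/-- A fixed vector `v` corresponds to its coefficients `c ω = ⟪b ω, v⟫`, with `v = ∑ c ω • r ω`;
being fixed means that the row vector `c` is fixed by the matrix. No independence of `b` or `r` is
needed. Rows are used because the first index of `PiMatrix` belongs to `F`, the range side. -/
theorem exists_fixed_iff_det_eq_zero [DecidableEq ι] {K : H →L[ℂ] H} {b r : ι → H}
    (hK : ∀ v, K v = ∑ ω, (inner ℂ (b ω) v : ℂ) • r ω) :
    (∃ v, v ≠ 0 ∧ K v = v) ↔
      (Matrix.of (fun ω ω' => (inner ℂ (b ω') (r ω) : ℂ)) - 1).det = 0 := by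
  rw [← Matrix.exists_vecMul_eq_zero_iff]
  have hsum : ∀ (c : ι → ℂ) (ω' : ι),
      Matrix.vecMul c (Matrix.of (fun ω ω' => (inner ℂ (b ω') (r ω) : ℂ)) - 1) ω' =
        inner ℂ (b ω') (∑ ω, c ω • r ω) - c ω' := by
    intro c ω'
    rw [Matrix.vecMul_sub, Matrix.vecMul_one, Pi.sub_apply, inner_sum]
    simp only [inner_smul_right, Matrix.vecMul, dotProduct, Matrix.of_apply]
  constructor
  · rintro ⟨v, hv, hKv⟩
    refine ⟨fun ω => inner ℂ (b ω) v, fun h0 => hv ?_, funext fun ω' => ?_⟩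
    · rw [← hKv, hK]
      exact Finset.sum_eq_zero fun ω _ => by rw [congrFun h0 ω, Pi.zero_apply, zero_smul]
    · rw [hsum, ← hK, hKv, sub_self, Pi.zero_apply]
  · rintro ⟨c, hc, hcM⟩
    have hin : ∀ ω', inner ℂ (b ω') (∑ ω, c ω • r ω) = c ω' := fun ω' =>
      sub_eq_zero.1 ((hsum c ω').symm.trans (congrFun hcM ω'))
    refine ⟨∑ ω, c ω • r ω, fun h0 => hc (funext fun ω' => ?_), ?_⟩
    · rw [← hin ω', h0, inner_zero_right, Pi.zero_apply]
    · rw [hK]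
      exact Finset.sum_congr rfl fun ω _ => by rw [hin]

end FiniteRankMatrix

/-! ### Factorization of `T - l` and the two determinants at regular points -/

section Factorization

variable {α β : Type} [MeasurableSpace α] [MeasurableSpace β] {μ : Measure α} {ν : Measure β}
  [IsFiniteMeasure μ] [IsFiniteMeasure ν] {n m : ℕ}

theorem isTensor_tens : IsTensor (tens : Lp ℂ 2 μ →ₗ[ℂ] Lp ℂ 2 ν →ₗ[ℂ] Lp ℂ 2 (μ.prod ν)) where
  inner_map f f' g g' := inner_tens f f' g g'
  total u hu := eq_zero_of_inner_tens u hu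

/-- Multiplication by an essentially bounded real function. -/
abbrev realMul {γ : Type*} [MeasurableSpace γ] {ρ : Measure γ} (h : Lp ℝ ∞ ρ) :
    Lp ℂ 2 ρ →L[ℂ] Lp ℂ 2 ρ :=
  mulOp ρ fun y => ((h y : ℝ) : ℂ)

/-- Multiplication by `h / (1 - τ h)`. -/
abbrev resMul {γ : Type*} [MeasurableSpace γ] {ρ : Measure γ} (h : Lp ℝ ∞ ρ) (τ : ℂ) :
    Lp ℂ 2 ρ →L[ℂ] Lp ℂ 2 ρ :=
  mulOp ρ fun y => ((h y : ℝ) : ℂ) / (1 - τ * ((h y : ℝ) : ℂ))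

variable {φ : Fin n → Lp ℂ 2 μ} {h : Fin n → Lp ℝ ∞ ν} {ψ : Fin m → Lp ℂ 2 ν}
  {p : Fin m → Lp ℝ ∞ μ} {l : ℂ}

theorem isPartial_T₁ : IsPartial tens φ (fun k => realMul (h k)) (T₁ φ h) :=
  T₁_tens φ h

theorem isPartial_T₂ :
    IsPartial (tens (μ := μ) (ν := ν)).flip ψ (fun k => realMul (p k)) (T₂ ψ p) :=
  T₂_tens ψ p

theorem isPartial_S₁ (hl : l ≠ 0) (hh : ∀ k, Separated ν l (h k)) :
    IsPartial tens φ (fun k => resMul (h k) l⁻¹) (S₁ φ h l⁻¹) :=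
  S₁_tens φ h l⁻¹ fun k => memLp_div_of_separated hl (hh k)

theorem isPartial_S₂ (hl : l ≠ 0) (hp : ∀ k, Separated μ l (p k)) :
    IsPartial (tens (μ := μ) (ν := ν)).flip ψ (fun k => resMul (p k) l⁻¹) (S₂ ψ p l⁻¹) :=
  S₂_tens ψ p l⁻¹ fun k => memLp_div_of_separated hl (hp k)

theorem isSelfAdjoint_T₁_add_T₂ : IsSelfAdjoint (T₁ φ h + T₂ ψ p) :=
  (isPartial_T₁.isSelfAdjoint isTensor_tens fun k => isSymmetric_mulOp (h k)).add
    (isPartial_T₂.isSelfAdjoint isTensor_tens.flip fun k => isSymmetric_mulOp (p k))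

theorem S₁_sub_smul_T₁_mul_S₁ (hφ : Orthonormal ℂ φ) (hl : l ≠ 0)
    (hh : ∀ k, Separated ν l (h k)) :
    S₁ φ h l⁻¹ - l⁻¹ • (T₁ φ h * S₁ φ h l⁻¹) = T₁ φ h :=
  isPartial_T₁.sub_smul_mul isTensor_tens hφ (isPartial_S₁ hl hh)
    fun k g => (mulOp_resolvent hl (hh k) g).1

/-- The invertible operator `1 - l⁻¹ T₁`. -/
def unitT₁ (hφ : Orthonormal ℂ φ) (hl : l ≠ 0) (hh : ∀ k, Separated ν l (h k)) :
    (Lp ℂ 2 (μ.prod ν) →L[ℂ] Lp ℂ 2 (μ.prod ν))ˣ :=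
  unitOneSub (S₁_sub_smul_T₁_mul_S₁ hφ hl hh)
    (isPartial_T₁.sub_smul_mul' isTensor_tens hφ (isPartial_S₁ hl hh)
      fun k g => (mulOp_resolvent hl (hh k) g).2)

/-- The invertible operator `1 - l⁻¹ T₂`. -/
def unitT₂ (hψ : Orthonormal ℂ ψ) (hl : l ≠ 0) (hp : ∀ k, Separated μ l (p k)) :
    (Lp ℂ 2 (μ.prod ν) →L[ℂ] Lp ℂ 2 (μ.prod ν))ˣ :=
  unitOneSub
    (isPartial_T₂.sub_smul_mul isTensor_tens.flip hψ (isPartial_S₂ hl hp)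
      fun k g => (mulOp_resolvent hl (hp k) g).1)
    (isPartial_T₂.sub_smul_mul' isTensor_tens.flip hψ (isPartial_S₂ hl hp)
      fun k g => (mulOp_resolvent hl (hp k) g).2)

theorem mem_G_of_separated (hφ : Orthonormal ℂ φ) (hψ : Orthonormal ℂ ψ) (hl : l ≠ 0)
    (hh : ∀ k, Separated ν l (h k)) (hp : ∀ k, Separated μ l (p k)) : l ∈ G φ h ψ p := by
  rw [G, compl_union]
  exact ⟨not_not.2 (mem_resolventSet_of_isUnit hl (unitT₁ hφ hl hh).isUnit),
    not_not.2 (mem_resolventSet_of_isUnit hl (unitT₂ hψ hl hp).isUnit)⟩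

/-- At these `l` the `Ring.inverse` in `W₁` is a true inverse, not the default value `0`. -/
theorem W₁_eq (hψ : Orthonormal ℂ ψ) (hl : l ≠ 0) (hp : ∀ k, Separated μ l (p k)) :
    W₁ φ h ψ p l⁻¹ = (1 + l⁻¹ • S₂ ψ p l⁻¹) * S₁ φ h l⁻¹ * T₂ ψ p := by
  have : Ring.inverse (1 - l⁻¹ • T₂ ψ p) = 1 + l⁻¹ • S₂ ψ p l⁻¹ :=
    Ring.inverse_unit (unitT₂ (p := p) hψ hl hp)
  rw [W₁, this]

theorem exists_factorization (hφ : Orthonormal ℂ φ) (hψ : Orthonormal ℂ ψ) (hl : l ≠ 0)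
    (hh : ∀ k, Separated ν l (h k)) (hp : ∀ k, Separated μ l (p k)) :
    ∃ A, IsUnit A ∧ T₁ φ h + T₂ ψ p - algebraMap ℂ _ l =
      A * (1 - (l⁻¹) ^ 2 • W₁ φ h ψ p l⁻¹) := by
  set U₁ := unitT₁ hφ hl hh
  set U₂ := unitT₂ hψ hl hp
  have hU₁ : (U₁ : Lp ℂ 2 (μ.prod ν) →L[ℂ] Lp ℂ 2 (μ.prod ν)) = 1 - l⁻¹ • T₁ φ h := rfl
  have hU₂ : (U₂ : Lp ℂ 2 (μ.prod ν) →L[ℂ] Lp ℂ 2 (μ.prod ν)) = 1 - l⁻¹ • T₂ ψ p := rfl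
  have hW : W₁ φ h ψ p l⁻¹ = (U₂⁻¹ : (Lp ℂ 2 (μ.prod ν) →L[ℂ] Lp ℂ 2 (μ.prod ν))ˣ) *
      (S₁ φ h l⁻¹ * T₂ ψ p) := by
    rw [W₁_eq hψ hl hp, mul_assoc]
    rfl
  have hUS : (U₁ : Lp ℂ 2 (μ.prod ν) →L[ℂ] Lp ℂ 2 (μ.prod ν)) * S₁ φ h l⁻¹ = T₁ φ h := by
    rw [hU₁, sub_mul, one_mul, smul_mul_assoc]
    exact S₁_sub_smul_T₁_mul_S₁ hφ hl hh
  refine ⟨(-l) • (U₁ * U₂ : Lp ℂ 2 (μ.prod ν) →L[ℂ] Lp ℂ 2 (μ.prod ν)), ?_, ?_⟩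
  · exact (U₁ * U₂).isUnit.smul (Units.mk0 (-l) (neg_ne_zero.2 hl))
  -- `U₂` cancels its inverse in `W₁` and `U₁ S₁ = T₁`, so the last term is `l⁻² T₁ T₂`, exactly the
  -- excess of `U₁ U₂` over `1 - l⁻¹ (T₁ + T₂)`.
  · have e : (U₁ * U₂ : Lp ℂ 2 (μ.prod ν) →L[ℂ] Lp ℂ 2 (μ.prod ν)) *
        (1 - (l⁻¹) ^ 2 • W₁ φ h ψ p l⁻¹) = 1 - l⁻¹ • (T₁ φ h + T₂ ψ p) := by
      rw [mul_sub, mul_one, mul_smul_comm, hW, mul_assoc, Units.mul_inv_cancel_left, ← mul_assoc,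
        hUS, hU₁, hU₂]
      simp only [mul_sub, sub_mul, mul_one, one_mul, smul_mul_assoc, mul_smul_comm, smul_smul,
        smul_add, smul_sub, pow_two]
      abel
    rw [smul_mul_assoc, e, smul_sub, smul_smul, neg_mul, mul_inv_cancel₀ hl, neg_smul, neg_smul,
      one_smul, Algebra.algebraMap_eq_smul_one]
    abel

/-- The vectors `φ_j ⊗ h_j / (1 - l⁻¹ h_j) ψ_k` spanning the range of `S₁ T₂`. -/
def rangeVec (φ : Fin n → Lp ℂ 2 μ) (h : Fin n → Lp ℝ ∞ ν) (ψ : Fin m → Lp ℂ 2 ν) (l : ℂ)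
    (ω : Fin m × Fin n) : Lp ℂ 2 (μ.prod ν) :=
  tens (φ ω.2) (resMul (h ω.2) l⁻¹ (ψ ω.1))

/-- The conjugates `p_k φ_j ⊗ ψ_k` of the functions `B`. -/
def dualVec (φ : Fin n → Lp ℂ 2 μ) (ψ : Fin m → Lp ℂ 2 ν) (p : Fin m → Lp ℝ ∞ μ)
    (ω : Fin m × Fin n) : Lp ℂ 2 (μ.prod ν) :=
  tens (realMul (p ω.1) (φ ω.2)) (ψ ω.1)

/-- It suffices to compare on product functions. There `T₂` leaves `ψ j` in the second variable and
`S₁` then leaves `φ k` in the first; the real multiplier `p j` moves across the inner product onto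
`φ k`. -/
theorem S₁_T₂_apply (hl : l ≠ 0) (hh : ∀ k, Separated ν l (h k)) (v : Lp ℂ 2 (μ.prod ν)) :
    S₁ φ h l⁻¹ (T₂ ψ p v) =
      ∑ ω, (inner ℂ (dualVec φ ψ p ω) v : ℂ) • rangeVec φ h ψ l ω := by
  have key : S₁ φ h l⁻¹ * T₂ ψ p =
      ∑ ω, (innerSL ℂ (dualVec φ ψ p ω)).smulRight (rangeVec φ h ψ l ω) := by
    refine isTensor_tens.ext fun f g => ?_
    rw [mul_apply_eq_comp, T₂_tens, map_sum, _root_.sum_apply, Fintype.sum_prod_type]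
    refine Finset.sum_congr rfl fun j _ => ?_
    rw [map_smul, isPartial_S₁ hl hh, Finset.smul_sum]
    refine Finset.sum_congr rfl fun k _ => ?_
    have hsym := isSymmetric_mulOp (p j) (φ k) f
    simp only [ContinuousLinearMap.coe_coe] at hsym
    rw [ContinuousLinearMap.smulRight_apply, innerSL_apply_apply, dualVec, inner_tens, hsym,
      smul_smul, mul_comm]
    rfl
  have := congrArg (fun B : Lp ℂ 2 (μ.prod ν) →L[ℂ] Lp ℂ 2 (μ.prod ν) => B v) key
  simpa only [mul_apply_eq_comp, _root_.sum_apply, ContinuousLinearMap.smulRight_apply,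
    innerSL_apply_apply] using this

theorem smul_W₁_apply (hψ : Orthonormal ℂ ψ) (hl : l ≠ 0) (hh : ∀ k, Separated ν l (h k))
    (hp : ∀ k, Separated μ l (p k)) (v : Lp ℂ 2 (μ.prod ν)) :
    ((l⁻¹) ^ 2 • W₁ φ h ψ p l⁻¹) v = ∑ ω, (inner ℂ (dualVec φ ψ p ω) v : ℂ) •
      (l⁻¹) ^ 2 • (rangeVec φ h ψ l ω + l⁻¹ • S₂ ψ p l⁻¹ (rangeVec φ h ψ l ω)) := by
  rw [W₁_eq hψ hl hp, smul_apply, mul_apply_eq_comp, mul_apply_eq_comp, S₁_T₂_apply hl hh,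
    map_sum, Finset.smul_sum]
  refine Finset.sum_congr rfl fun ω _ => ?_
  rw [map_smul, smul_comm]
  rfl

/-- Source of the functions `F`. From `x / (1 - l⁻¹ x) = l * (x / (l - x))`, each multiplier
contributes a factor `l`: one in the first term, and two against one `l⁻¹` in the sum. -/
theorem coeFn_resolvent_rangeVec (hl : l ≠ 0) (hh : ∀ k, Separated ν l (h k))
    (hp : ∀ k, Separated μ l (p k)) (ω : Fin m × Fin n) :
    (rangeVec φ h ψ l ω + l⁻¹ • S₂ ψ p l⁻¹ (rangeVec φ h ψ l ω) : Lp ℂ 2 (μ.prod ν))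
      =ᵐ[μ.prod ν] fun z => l * F φ h ψ p l ω z := by
  have hdiv : ∀ x : ℂ, x / (1 - l⁻¹ * x) = l * (x / (l - x)) := fun x => by
    rw [show 1 - l⁻¹ * x = l⁻¹ * (l - x) by rw [mul_sub, inv_mul_cancel₀ hl],
      div_mul_eq_div_div, div_inv_eq_mul, mul_comm x l, mul_div_assoc]
  have hinner : ∀ i, (inner ℂ (ψ i) (resMul (h ω.2) l⁻¹ (ψ ω.1)) : ℂ) =
      l * ∫ ξ, ((h ω.2 ξ : ℝ) : ℂ) / (l - ((h ω.2 ξ : ℝ) : ℂ)) * ψ ω.1 ξ * conj (ψ i ξ) ∂ν := by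
    intro i
    rw [L2.inner_def, ← integral_const_mul]
    refine integral_congr_ae ?_
    filter_upwards [coeFn_mulOp (memLp_div_of_separated hl (hh ω.2)) (ψ ω.1)] with y hy
    rw [hy, RCLike.inner_apply, hdiv]
    ring
  have hS : S₂ ψ p l⁻¹ (rangeVec φ h ψ l ω) =
      ∑ i, (inner ℂ (ψ i) (resMul (h ω.2) l⁻¹ (ψ ω.1)) : ℂ) •
        tens (resMul (p i) l⁻¹ (φ ω.2)) (ψ i) :=
    isPartial_S₂ hl hp _ _
  have h5 := ae_all_iff.2 fun i =>
    Lp.coeFn_smul (inner ℂ (ψ i) (resMul (h ω.2) l⁻¹ (ψ ω.1)) : ℂ)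
      (tens (resMul (p i) l⁻¹ (φ ω.2)) (ψ i))
  have h6 := ae_all_iff.2 fun i => coeFn_tens (resMul (p i) l⁻¹ (φ ω.2)) (ψ i)
  have h7 := ae_all_iff.2 fun i => ae_fst (ν := ν)
    (coeFn_mulOp (memLp_div_of_separated hl (hp i)) (φ ω.2))
  rw [hS]
  filter_upwards [Lp.coeFn_add (rangeVec φ h ψ l ω)
      (l⁻¹ • ∑ i, (inner ℂ (ψ i) (resMul (h ω.2) l⁻¹ (ψ ω.1)) : ℂ) •
        tens (resMul (p i) l⁻¹ (φ ω.2)) (ψ i)),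
    Lp.coeFn_smul l⁻¹ (∑ i, (inner ℂ (ψ i) (resMul (h ω.2) l⁻¹ (ψ ω.1)) : ℂ) •
        tens (resMul (p i) l⁻¹ (φ ω.2)) (ψ i)),
    coeFn_sum_ae Finset.univ (fun i => (inner ℂ (ψ i) (resMul (h ω.2) l⁻¹ (ψ ω.1)) : ℂ) •
        tens (resMul (p i) l⁻¹ (φ ω.2)) (ψ i)),
    coeFn_tens (φ ω.2) (resMul (h ω.2) l⁻¹ (ψ ω.1)),
    ae_snd (μ := μ) (coeFn_mulOp (memLp_div_of_separated hl (hh ω.2)) (ψ ω.1)), h5, h6, h7]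
    with z h1 h2 h3 h4 h8 h5 h6 h7
  rw [h1, Pi.add_apply, h2, Pi.smul_apply, h3, rangeVec, h4, h8, F, hdiv, mul_add, mul_add,
    smul_eq_mul, Finset.mul_sum, Finset.mul_sum, Finset.mul_sum]
  congr 1
  · ring
  · refine Finset.sum_congr rfl fun i _ => ?_
    rw [h5 i, Pi.smul_apply, h6 i, h7 i, hdiv, hinner i, smul_eq_mul]
    field_simp

theorem inner_dualVec_resolvent (hl : l ≠ 0) (hh : ∀ k, Separated ν l (h k))
    (hp : ∀ k, Separated μ l (p k)) (ω ω' : Fin m × Fin n) :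
    (inner ℂ (dualVec φ ψ p ω')
      ((l⁻¹) ^ 2 • (rangeVec φ h ψ l ω + l⁻¹ • S₂ ψ p l⁻¹ (rangeVec φ h ψ l ω))) : ℂ) =
      l⁻¹ * PiMatrix φ h ψ p l ω ω' := by
  have e : (inner ℂ (dualVec φ ψ p ω')
      (rangeVec φ h ψ l ω + l⁻¹ • S₂ ψ p l⁻¹ (rangeVec φ h ψ l ω)) : ℂ) =
      l * PiMatrix φ h ψ p l ω ω' := by
    rw [L2.inner_def, PiMatrix, Matrix.of_apply, ← integral_const_mul]
    refine integral_congr_ae ?_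
    filter_upwards [coeFn_resolvent_rangeVec hl hh hp ω,
      coeFn_tens (realMul (p ω'.1) (φ ω'.2)) (ψ ω'.1),
      ae_fst (ν := ν) (coeFn_mulOp (memLp_ofReal (p ω'.1)) (φ ω'.2))] with z h1 h2 h3
    rw [h1, dualVec, h2, h3, B, RCLike.inner_apply]
    simp only [map_mul, Complex.conj_ofReal]
    ring
  rw [inner_smul_right, e]
  field_simp

theorem finiteDimensional_range_W₁ (hψ : Orthonormal ℂ ψ) (hl : l ≠ 0)
    (hh : ∀ k, Separated ν l (h k)) (hp : ∀ k, Separated μ l (p k)) :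
    FiniteDimensional ℂ (LinearMap.range
      (((l⁻¹) ^ 2 • W₁ φ h ψ p l⁻¹ : Lp ℂ 2 (μ.prod ν) →L[ℂ] Lp ℂ 2 (μ.prod ν)) :
        Lp ℂ 2 (μ.prod ν) →ₗ[ℂ] Lp ℂ 2 (μ.prod ν))) :=
  finiteDimensional_range_of_sum (smul_W₁_apply hψ hl hh hp)

theorem fredholmDet_W₁_eq_zero_iff (hψ : Orthonormal ℂ ψ) (hl : l ≠ 0)
    (hh : ∀ k, Separated ν l (h k)) (hp : ∀ k, Separated μ l (p k)) :
    fredholmDet ((l⁻¹) ^ 2 • W₁ φ h ψ p l⁻¹) = 0 ↔ Delta φ h ψ p l = 0 := by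
  have := finiteDimensional_range_W₁ (φ := φ) hψ hl hh hp
  rw [fredholmDet_eq_zero_iff, exists_fixed_iff_det_eq_zero (smul_W₁_apply hψ hl hh hp)]
  -- The coordinate matrix of `l⁻² W₁` is `l⁻¹ Π(l)`, so the two determinants differ by a nonzero
  -- power of `l`.
  have e : PiMatrix φ h ψ p l - l • (1 : Matrix (Fin m × Fin n) (Fin m × Fin n) ℂ) =
      l • (Matrix.of (fun ω ω' => (inner ℂ (dualVec φ ψ p ω') ((l⁻¹) ^ 2 •
        (rangeVec φ h ψ l ω + l⁻¹ • S₂ ψ p l⁻¹ (rangeVec φ h ψ l ω))) : ℂ)) - 1) := by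
    rw [smul_sub]
    congr 1
    ext ω ω'
    rw [Matrix.smul_apply, Matrix.of_apply, inner_dualVec_resolvent hl hh hp, smul_eq_mul,
      mul_inv_cancel_left₀ hl]
  rw [Delta, e, Matrix.det_smul, mul_eq_zero, or_iff_right (pow_ne_zero _ hl)]

/-- By the factorization, eigenvectors of `T` for `l` are the fixed vectors of `l⁻² W₁`. Conversely
a fixed vector makes `l` an eigenvalue, and isolation and finite multiplicity come for free. -/
theorem mem_discreteSpectrum_iff (hφ : Orthonormal ℂ φ) (hψ : Orthonormal ℂ ψ) (hl : l ≠ 0)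
    (hh : ∀ k, Separated ν l (h k)) (hp : ∀ k, Separated μ l (p k)) :
    l ∈ discreteSpectrum (T₁ φ h + T₂ ψ p) ↔ fredholmDet ((l⁻¹) ^ 2 • W₁ φ h ψ p l⁻¹) = 0 := by
  have hfin := finiteDimensional_range_W₁ (φ := φ) hψ hl hh hp
  obtain ⟨A, hA, hTA⟩ := exists_factorization hφ hψ hl hh hp
  rw [fredholmDet_eq_zero_iff]
  refine ⟨fun hd => ?_,
    fun hv => mem_discreteSpectrum_of_isUnit_mul isSelfAdjoint_T₁_add_T₂ hA hfin hTA hv⟩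
  obtain ⟨v, hv⟩ := hd.2.1.exists_hasEigenvector
  refine ⟨v, hv.2, ?_⟩
  have h0 : A ((1 - (l⁻¹) ^ 2 • W₁ φ h ψ p l⁻¹) v) = 0 := by
    have h1 : (T₁ φ h + T₂ ψ p) v = l • v := Module.End.mem_eigenspace_iff.1 hv.1
    rw [← mul_apply_eq_comp, ← hTA, sub_apply, h1, Algebra.algebraMap_eq_smul_one]
    simp
  have h2 := (ContinuousLinearMap.isUnit_iff_bijective.1 hA).1 (h0.trans (map_zero A).symm)
  rw [sub_apply, one_apply_eq_self] at h2
  exact (sub_eq_zero.1 h2).symm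

end Factorization

/-! ### Intervals: exclusion of the points that are not regular -/

section Interval

variable {a b c d : ℝ} {n m : ℕ}
  {φ : Fin n → Lp ℂ 2 (volume.restrict (Icc a b))}
  {h : Fin n → Lp ℝ ∞ (volume.restrict (Icc c d))}
  {ψ : Fin m → Lp ℂ 2 (volume.restrict (Icc c d))}
  {p : Fin m → Lp ℝ ∞ (volume.restrict (Icc a b))} {l : ℂ}

/-- `l` is nonzero and lies outside the essential ranges of all `h k` and `p j`. -/
def Regular (h : Fin n → Lp ℝ ∞ (volume.restrict (Icc c d)))
    (p : Fin m → Lp ℝ ∞ (volume.restrict (Icc a b))) (l : ℂ) : Prop :=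
  l ≠ 0 ∧ (∀ k, Separated (volume.restrict (Icc c d)) l (h k)) ∧
    ∀ j, Separated (volume.restrict (Icc a b)) l (p j)

theorem exists_approx_T₁ (hab : a < b) (hcd : c < d) (hφ : Orthonormal ℂ φ)
    (hl : l = 0 ∨ ∃ k, ¬ Separated (volume.restrict (Icc c d)) l (h k)) {ε : ℝ} (hε : 0 < ε)
    {V : Type} [AddCommGroup V] [Module ℂ V] [FiniteDimensional ℂ V]
    (L : Lp ℂ 2 ((volume.restrict (Icc a b)).prod (volume.restrict (Icc c d))) →ₗ[ℂ] V) :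
    ∃ v, v ≠ 0 ∧ L v = 0 ∧ T₂ ψ p v = 0 ∧ ‖T₁ φ h v - l • v‖ ≤ ε * ‖v‖ :=
  exists_approx_of_isPartial isTensor_tens hφ isPartial_T₁ isPartial_T₂
    (not_finiteDimensional_Lp hab) (not_finiteDimensional_Lp hcd)
    (hl.imp_right fun ⟨k, hk⟩ => ⟨k, approxEigen_mulOp hk⟩) hε L

theorem exists_approx_T₂ (hab : a < b) (hcd : c < d) (hψ : Orthonormal ℂ ψ)
    (hl : l = 0 ∨ ∃ k, ¬ Separated (volume.restrict (Icc a b)) l (p k)) {ε : ℝ} (hε : 0 < ε)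
    {V : Type} [AddCommGroup V] [Module ℂ V] [FiniteDimensional ℂ V]
    (L : Lp ℂ 2 ((volume.restrict (Icc a b)).prod (volume.restrict (Icc c d))) →ₗ[ℂ] V) :
    ∃ v, v ≠ 0 ∧ L v = 0 ∧ T₁ φ h v = 0 ∧ ‖T₂ ψ p v - l • v‖ ≤ ε * ‖v‖ :=
  exists_approx_of_isPartial isTensor_tens.flip hψ isPartial_T₂
    -- With the roles exchanged, the annihilated operator is `T₁` and must be partial for the doubly
    -- flipped tensor map.
    (LinearMap.flip_flip (tens (μ := volume.restrict (Icc a b)) (ν := volume.restrict (Icc c d))) ▸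
      isPartial_T₁)
    (not_finiteDimensional_Lp hcd) (not_finiteDimensional_Lp hab)
    (hl.imp_right fun ⟨k, hk⟩ => ⟨k, approxEigen_mulOp hk⟩) hε L

/-- Approximate eigenvectors rule out points that are not regular, with no side condition (`L = 0`);
at regular points the explicit resolvents exist. -/
theorem mem_G_iff (hab : a < b) (hcd : c < d) (hφ : Orthonormal ℂ φ) (hψ : Orthonormal ℂ ψ) :
    l ∈ G φ h ψ p ↔ Regular h p l := by
  refine ⟨fun hG => ?_, fun ⟨hl, hh, hp⟩ => mem_G_of_separated hφ hψ hl hh hp⟩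
  rw [G, compl_union] at hG
  have h1 : ¬ (l = 0 ∨ ∃ k, ¬ Separated (volume.restrict (Icc c d)) l (h k)) := fun hl =>
    not_mem_resolventSet_of_approx (fun ε hε => by
      obtain ⟨v, hv, -, -, hv'⟩ :=
        exists_approx_T₁ (ψ := ψ) (p := p) hab hcd hφ hl hε (0 : _ →ₗ[ℂ] ℂ)
      exact ⟨v, hv, hv'⟩) (not_not.1 hG.1)
  have h2 : ¬ (l = 0 ∨ ∃ k, ¬ Separated (volume.restrict (Icc a b)) l (p k)) := fun hl =>
    not_mem_resolventSet_of_approx (fun ε hε => by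
      obtain ⟨v, hv, -, -, hv'⟩ :=
        exists_approx_T₂ (φ := φ) (h := h) hab hcd hψ hl hε (0 : _ →ₗ[ℂ] ℂ)
      exact ⟨v, hv, hv'⟩) (not_not.1 hG.2)
  push Not at h1 h2
  exact ⟨h1.1, h1.2, h2.2⟩

/-- The approximate eigenvectors of one summand are annihilated by the other, so they serve for the
sum, now with the side condition `L` in full use. -/
theorem regular_of_mem_discreteSpectrum (hab : a < b) (hcd : c < d) (hφ : Orthonormal ℂ φ)
    (hψ : Orthonormal ℂ ψ) (hl : l ∈ discreteSpectrum (T₁ φ h + T₂ ψ p)) : Regular h p l := by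
  have h1 : ¬ (l = 0 ∨ ∃ k, ¬ Separated (volume.restrict (Icc c d)) l (h k)) := fun hbad =>
    not_mem_discreteSpectrum_of_approx isSelfAdjoint_T₁_add_T₂ (fun ε hε V _ _ _ L => by
      obtain ⟨v, hv, hLv, hTv, hv'⟩ :=
        exists_approx_T₁ (ψ := ψ) (p := p) hab hcd hφ hbad hε L
      exact ⟨v, hv, hLv, by rwa [add_apply, hTv, add_zero]⟩) hl
  have h2 : ¬ (l = 0 ∨ ∃ k, ¬ Separated (volume.restrict (Icc a b)) l (p k)) := fun hbad =>
    not_mem_discreteSpectrum_of_approx isSelfAdjoint_T₁_add_T₂ (fun ε hε V _ _ _ L => by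
      obtain ⟨v, hv, hLv, hTv, hv'⟩ :=
        exists_approx_T₂ (φ := φ) (h := h) hab hcd hψ hbad hε L
      exact ⟨v, hv, hLv, by rwa [add_apply, hTv, zero_add]⟩) hl
  push Not at h1 h2
  exact ⟨h1.1, h1.2, h2.2⟩

theorem mem_D₀_iff (hab : a < b) (hcd : c < d) (hφ : Orthonormal ℂ φ) (hψ : Orthonormal ℂ ψ) :
    l ∈ D₀ φ h ψ p ↔ Regular h p l ∧ fredholmDet ((l⁻¹) ^ 2 • W₁ φ h ψ p l⁻¹) = 0 := by
  have hmem : ∀ w, w ∈ resolventSet ℂ (T₁ φ h) ∩ resolventSet ℂ (T₂ ψ p) ↔ Regular h p w := by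
    intro w
    rw [← mem_G_iff hab hcd hφ hψ, G, compl_union]
    simp only [spectrum, compl_compl]
  constructor
  · rintro ⟨τ, ⟨-, hτ, hdet⟩, rfl⟩
    rw [one_div, inv_inv]
    exact ⟨(hmem _).1 hτ, hdet⟩
  · rintro ⟨hl, hdet⟩
    refine ⟨l⁻¹, ⟨inv_ne_zero hl.1, ?_, hdet⟩, by rw [one_div, inv_inv]⟩
    rw [inv_inv]
    exact (hmem l).2 hl

end Interval

end PartialInt

end

theorem theorem5p5 (a b c d : ℝ) (hab : a < b) (hcd : c < d) (n m : ℕ)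
    (φ : Fin n → Lp ℂ 2 (volume.restrict (Icc a b))) (hφ : Orthonormal ℂ φ)
    (h : Fin n → Lp ℝ ∞ (volume.restrict (Icc c d)))
    (ψ : Fin m → Lp ℂ 2 (volume.restrict (Icc c d))) (hψ : Orthonormal ℂ ψ)
    (p : Fin m → Lp ℝ ∞ (volume.restrict (Icc a b))) :
    PartialInt.discreteSpectrum (PartialInt.T₁ φ h + PartialInt.T₂ ψ p) = PartialInt.D₀ φ h ψ p ∧
    PartialInt.D₀ φ h ψ p = {l | l ∈ PartialInt.G φ h ψ p ∧ PartialInt.Delta φ h ψ p l = 0} := by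
  constructor
  · ext l
    rw [PartialInt.mem_D₀_iff hab hcd hφ hψ]
    refine ⟨fun hl => ?_, fun ⟨⟨hl, hh, hp⟩, hdet⟩ =>
      (PartialInt.mem_discreteSpectrum_iff hφ hψ hl hh hp).2 hdet⟩
    have hreg := PartialInt.regular_of_mem_discreteSpectrum hab hcd hφ hψ hl
    exact ⟨hreg, (PartialInt.mem_discreteSpectrum_iff hφ hψ hreg.1 hreg.2.1 hreg.2.2).1 hl⟩
  · ext l
    rw [PartialInt.mem_D₀_iff hab hcd hφ hψ, mem_ofPred_eq, PartialInt.mem_G_iff hab hcd hφ hψ]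
    exact and_congr_right fun ⟨hl, hh, hp⟩ =>
      PartialInt.fredholmDet_W₁_eq_zero_iff hψ hl hh hp
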